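/- **Setting.** There are $m$ candidates $C$ and $n$ voters. A preference order is a strict linear order on $C$; $P(a,b)$ means that $P$ ranks $a$ above $b$. The Borda score of $c$ from a ballot $P$ is $1+|\{c' : P(c,c')\}|$; the winner of a joint profile is the candidate with the largest total score, ties being broken by a fixed linear order on $C$. Each voter $v$ has given a set $Q_v$ of pairwise responses ($(a,b)\in Q_v$ means "$a\succ b$"), with transitive closure $CL(Q_v)$; $P\models Q_v$ means $P(a,b)$ for all $(a,b)\in CL(Q_v)$. The set $PW(\mathbf Q)$ of possible winners consists of the winners of all joint profiles $\mathbf P$ with $P_v\models Q_v$ for every voter $v$. A joint ballot $R_{-i}$ of the voters other than $i$ is a *possible world* for voter $i$ if there are responses $Q'_{-i}$ with $R_v\models Q'_v$ for all $v\ne i$ and $PW(Q'_{-i},Q_i)=PW(\mathbf Q)$. An order $P_i'$ is *locally dominant* over $P_i$ if in at least one possible world the winner of $(R_{-i},P_i')$ is ranked by $P_i$ above the winner of $(R_{-i},P_i)$, and in no possible world it is ranked below it. The swap distance $d_{swap}(P,P')$ is the number of pairs of candidates ordered differently by $P$ and $P'$. **Common givens.** $P_i\models Q_i$ is the current order of voter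 $i$; the query is about $c_j,c_k$, where $P_i(c_j,c_k)$, and neither $(c_j,c_k)$ nor $(c_k,c_j)$ is in $CL(Q_i)$. The vector $PW_i=[pw_1,\dots,pw_l]$ lists $PW(\mathbf Q)$ in the order of $P_i$. Let $\mu(P_i)$ be the set of the orders $P$ that minimise $d_{swap}(P_i,P)$ among all $P\models Q_i\cup\{(c_k,c_j)\}$. **Algorithm** (input $P_i$, $CL(Q_i)$, $PW_i$, $c_j$, $c_k$). Write $a\succ b$ for $P_i(a,b)$ and $[pw_1;pw_l]$ for the set of candidates ranked by $P_i$ from $pw_1$ to $pw_l$, both included. If $PW_i$ is empty or none of the three conditions ($c_j\succ pw_1$ and $pw_l\succ c_k$), ($c_j\succ pw_1$ and $c_k\in[pw_1;pw_l]$), ($pw_l\succ c_k$ and $c_j\in[pw_1;pw_l]$) holds, return $P_i$. Otherwise put $d^{abs}=d^{loc}=\infty$, $P^{loc}=P_i$, and for each $z$ from $c_j$ to $c_k$ (both included) in the order of $P_i$ form $$P_z=(X_{good},\,Y_{bad},\,c_k,\,c_j,\,X_{bad},\,Y_{good}),$$ where $X_{bad}$ (resp. $X_{good}$) consists of the $x\succ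 z$ with $(c_j,x)\in CL(Q_i)$ (resp. with $(c_j,x)\notin CL(Q_i)$ and $x\neq c_j$), and $Y_{bad}$ (resp. $Y_{good}$) consists of the $y$ with $y=z$ or $z\succ y$ such that $(y,c_k)\in CL(Q_i)$ (resp. $(y,c_k)\notin CL(Q_i)$ and $y\ne c_j,c_k$), all ordered by $P_i$. Let $d=d_{swap}(P_i,P_z)$. If $d<d^{abs}$, put $d^{abs}=d$. If $d<d^{loc}$ and $P_z$ passes the dominance test, put $d^{loc}=d$ and $P^{loc}=P_z$; the test is that $l\ge 1$, that $P_z$ orders the possible winners as $P_i$ does, that no interval between two consecutive possible winners contains fewer candidates in $P_z$ than in $P_i$, and that at least one such interval contains more. After the loop return $P_i$ if $d^{abs}<d^{loc}$, and $P^{loc}$ otherwise. **Theorem.** Assume the common givens. 1. The algorithm runs in time polynomial in the number $m$ of candidates, uniformly in the number $n$ of voters (hence in time polynomial in the numbers of voters and candidates). Time is the number of routine calls of an explicit list implementation, each of which performs a bounded number of elementary operations. 2. If there are at least four voters and some order $P_i'$ is locally dominant over $P_i$ (Condition-1) and belongs to $\mu(P_i)$ (Condition-2), then the algorithm returns an order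 that satisfies both conditions. 3. Every element of $\mu(P_i)$ is one of the orders $P_z$, for some $z$ from $c_j$ to $c_k$ in the order of $P_i$. -/

import Mathlib

namespace IterVoting

/-! ## Preference orders, responses and the Borda rule

Candidates are `Fin m`, voters are `Fin n`. -/

/-- A preference order (ranking) over the `m` candidates: the list of all candidates,
most preferred first. -/
@[ext]
structure Pref (m : ℕ) where
  order : List (Fin m)
  nodup : order.Nodup
  complete : ∀ c, c ∈ order

/-- `P.prefers a b`: candidate `a` is strictly preferred to `b` according to `P`. -/
def Pref.prefers {m : ℕ} (P : Pref m) (a b : Fin m) : Prop :=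
  P.order.idxOf a < P.order.idxOf b

instance {m : ℕ} (P : Pref m) (a b : Fin m) : Decidable (P.prefers a b) :=
  inferInstanceAs (Decidable (P.order.idxOf a < P.order.idxOf b))

/-- A collection of responses of one voter to comparison queries: `(a, b)` stands for the
response `a ≻ b`. -/
abbrev Responses (m : ℕ) : Type := Set (Fin m × Fin m)

/-- The transitive closure of a set of responses. -/
def CL {m : ℕ} (Q : Responses m) : Responses m :=
  {p | Relation.TransGen (fun a b => (a, b) ∈ Q) p.1 p.2}

/-- `P` is consistent with (extends) the responses `Q`. -/
def Models {m : ℕ} (P : Pref m) (Q : Responses m) : Prop :=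
  ∀ a b, (a, b) ∈ CL Q → P.prefers a b

/-- Borda score of candidate `c` from a ballot `P`. -/
def score {m : ℕ} (P : Pref m) (c : Fin m) : ℕ :=
  1 + (Finset.univ.filter (fun c' => P.prefers c c')).card

/-- Total Borda score of candidate `c` from a joint profile. -/
def totalScore {n m : ℕ} (R : Fin n → Pref m) (c : Fin m) : ℕ :=
  ∑ v, score (R v) c

/-- `c` is the Borda winner of the joint profile `R`; ties are broken by the fixed order `T`
over the candidates. -/
def IsWinner {n m : ℕ} (T : Pref m) (R : Fin n → Pref m) (c : Fin m) : Prop :=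
  ∀ c', c' ≠ c → totalScore R c' < totalScore R c ∨
    (totalScore R c' = totalScore R c ∧ T.prefers c c')

/-- The set of possible winners for the joint responses `Q`. -/
def possibleWinners {n m : ℕ} (T : Pref m) (Q : Fin n → Responses m) : Set (Fin m) :=
  {c | ∃ R : Fin n → Pref m, (∀ v, Models (R v) (Q v)) ∧ IsWinner T R c}

/-! ## Local dominance and minimal swap distance -/

/-- `R` (its component at `i` is ignored) is a possible world from the perspective of voter `i`,
when `Q i` are the responses of voter `i` and `possibleWinners T Q` is the announced set of
possible winners: the ballots of the other voters extend some responses of theirs that, together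
with `Q i`, lead to the same set of possible winners. -/
def IsPossibleWorld {n m : ℕ} (T : Pref m) (Q : Fin n → Responses m) (i : Fin n)
    (R : Fin n → Pref m) : Prop :=
  ∃ Q' : Fin n → Responses m, Q' i = Q i ∧ (∀ v, v ≠ i → Models (R v) (Q' v)) ∧
    possibleWinners T Q' = possibleWinners T Q

/-- `P'` is locally dominant over `P` for voter `i`: in some possible world the outcome of `P'` is
ranked (by the voter, whose current order is `P`) higher than the outcome of `P`, and in no
possible world is it ranked lower. -/
def LocallyDominant {n m : ℕ} (T : Pref m) (Q : Fin n → Responses m) (i : Fin n)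
    (P P' : Pref m) : Prop :=
  (∃ R, IsPossibleWorld T Q i R ∧ ∃ x y, IsWinner T (Function.update R i P') x ∧
    IsWinner T (Function.update R i P) y ∧ P.prefers x y) ∧
  (∀ R, IsPossibleWorld T Q i R → ∀ x y, IsWinner T (Function.update R i P') x →
    IsWinner T (Function.update R i P) y → ¬ P.prefers y x)

/-- Swap distance: the number of pairs of candidates that are ordered differently. -/
def swapDist {m : ℕ} (P P' : Pref m) : ℕ :=
  (Finset.univ.filter
    (fun p : Fin m × Fin m => P.prefers p.1 p.2 ∧ P'.prefers p.2 p.1)).card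

/-- The set `μ(P)`: the preference orders at minimal swap distance from `P` among all those
consistent with the responses `Q` and the additional response `ck ≻ cj`. -/
def mu {m : ℕ} (Q : Responses m) (P : Pref m) (cj ck : Fin m) : Set (Pref m) :=
  {P' | Models P' (Q ∪ {(ck, cj)}) ∧
    ∀ P'', Models P'' (Q ∪ {(ck, cj)}) → swapDist P P' ≤ swapDist P P''}

/-- The common givens: voter `i` has current order `P`, consistent with the responses given so far;
`q` lists the closure of these responses; the query is about `cj`, `ck` with `cj ≻ ck` according
to `P`, and no order between these two has been committed to; `pw` is the vector of possible
winners, in the order of `P`. -/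
structure CommonGivens {n m : ℕ} (T : Pref m) (Q : Fin n → Responses m) (i : Fin n)
    (P : Pref m) (q : List (Fin m × Fin m)) (pw : List (Fin m)) (cj ck : Fin m) : Prop where
  consistent : Models P (Q i)
  closure_nodup : q.Nodup
  closure_mem : ∀ p, p ∈ q ↔ p ∈ CL (Q i)
  query : P.prefers cj ck
  uncommitted : (cj, ck) ∉ CL (Q i) ∧ (ck, cj) ∉ CL (Q i)
  pw_sorted : pw.Pairwise P.prefers
  pw_mem : ∀ c, c ∈ pw ↔ c ∈ possibleWinners T Q

/-! ## The algorithm, with its running time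

The time is the number of routine calls, recursive calls included: every routine below that
inspects a list charges one unit when it is called and recurses on the tail. Between two calls,
a routine performs only a bounded number of elementary operations: inspecting or building one list
cell, and comparing or adding two candidate labels or two numbers. -/

/-- A result together with the number of time units spent on it. -/
structure Timed (α : Type) where
  val : α
  time : ℕ

instance : Monad Timed where
  pure a := ⟨a, 0⟩
  bind x f := ⟨(f x.val).val, x.time + (f x.val).time⟩

/-- Spend one time unit. -/
def tick : Timed Unit := ⟨(), 1⟩

/-- Is `p` in the list of pairs? -/
def memT {m : ℕ} (p : Fin m × Fin m) : List (Fin m × Fin m) → Timed Bool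
  | [] => do tick; return false
  | x :: l => do
    tick
    if x.1 = p.1 ∧ x.2 = p.2 then return true else memT p l

/-- Position of `c` in an order. -/
def indexT {m : ℕ} (c : Fin m) : List (Fin m) → Timed ℕ
  | [] => do tick; return 0
  | x :: l => do
    tick
    if x = c then return 0 else
      let k ← indexT c l
      return k + 1

/-- Does `a` come strictly before `b` in the order? -/
def beforeT {m : ℕ} (a b : Fin m) (P : List (Fin m)) : Timed Bool := do
  tick
  let x ← indexT a P
  let y ← indexT b P
  return decide (x < y)

/-- The last entry of the nonempty list `a :: l`. -/
def lastT {m : ℕ} (a : Fin m) : List (Fin m) → Timed (Fin m)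
  | [] => do tick; return a
  | b :: l => do tick; lastT b l

/-- The entries strictly before `z`, i.e. the interval `(∞; z)`. -/
def aboveT {m : ℕ} (z : Fin m) : List (Fin m) → Timed (List (Fin m))
  | [] => do tick; return []
  | x :: l => do
    tick
    if x = z then return [] else
      let t ← aboveT z l
      return x :: t

/-- The entries from `z` on, i.e. the interval `[z; -∞)`. -/
def fromT {m : ℕ} (z : Fin m) : List (Fin m) → Timed (List (Fin m))
  | [] => do tick; return []
  | x :: l => do
    tick
    if x = z then return x :: l else fromT z l

/-- The entries up to and including `z`, i.e. the interval `(∞; z]`. -/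
def uptoT {m : ℕ} (z : Fin m) : List (Fin m) → Timed (List (Fin m))
  | [] => do tick; return []
  | x :: l => do
    tick
    if x = z then return [x] else
      let t ← uptoT z l
      return x :: t

/-- The entries that pass the test `f`, in the same order. -/
def filterT {m : ℕ} (f : Fin m → Timed Bool) : List (Fin m) → Timed (List (Fin m))
  | [] => do tick; return []
  | x :: l => do
    tick
    let b ← f x
    let t ← filterT f l
    return if b then x :: t else t

/-- Concatenation. -/
def appendT {m : ℕ} (l' : List (Fin m)) : List (Fin m) → Timed (List (Fin m))
  | [] => do tick; return l'
  | x :: l => do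
    tick
    let t ← appendT l' l
    return x :: t

/-- The number of entries of a list that come before `x` in `P`. -/
def countBeforeT {m : ℕ} (P : List (Fin m)) (x : Fin m) : List (Fin m) → Timed ℕ
  | [] => do tick; return 0
  | y :: l => do
    tick
    let b ← beforeT y x P
    let k ← countBeforeT P x l
    return if b then k + 1 else k

/-- The swap distance of an order from `P`: the number of its pairs that `P` orders differently. -/
def swapDistT {m : ℕ} (P : List (Fin m)) : List (Fin m) → Timed ℕ
  | [] => do tick; return 0
  | x :: l => do
    tick
    let k ← countBeforeT P x l
    let r ← swapDistT P l
    return k + r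

/-- Scan of the consecutive possible winners `a :: l`. First output: in `P'` they come in this
order and no interval between two consecutive ones is smaller than in `P`. Second output: some
interval between two consecutive ones is larger in `P'` than in `P`. -/
def scanT {m : ℕ} (P P' : List (Fin m)) (a : Fin m) : List (Fin m) → Timed (Bool × Bool)
  | [] => do tick; return (true, false)
  | b :: l => do
    tick
    let x ← indexT a P
    let y ← indexT b P
    let x' ← indexT a P'
    let y' ← indexT b P'
    let r ← scanT P P' b l
    return (decide (x' < y' ∧ y + x' ≤ y' + x) && r.1, decide (y + x' < y' + x) || r.2)

/-- The algorithm's test for local dominance of `P'` over `P`: the order of the possible winners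
is kept, no interval between consecutive ones decreases, and at least one of them grows. -/
def isLDT {m : ℕ} (P P' : List (Fin m)) : List (Fin m) → Timed Bool
  | [] => do tick; return false
  | a :: l => do
    tick
    let r ← scanT P P' a l
    return r.1 && r.2

/-- The preliminary test: with `pw₁` and `pwₗ` the first and the last possible winner,
`cj ≻ pw₁` and `pwₗ ≻ ck`, or `cj ≻ pw₁` and `ck ∈ [pw₁; pwₗ]`, or `pwₗ ≻ ck` and
`cj ∈ [pw₁; pwₗ]`. -/
def feasibleT {m : ℕ} (P : List (Fin m)) (cj ck : Fin m) : List (Fin m) → Timed Bool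
  | [] => do tick; return false
  | a :: l => do
    tick
    let z ← lastT a l
    let jAbove ← beforeT cj a P
    let jBelow ← beforeT z cj P
    let kAbove ← beforeT ck a P
    let kBelow ← beforeT z ck P
    return (jAbove && kBelow) || (jAbove && (!kAbove && !kBelow)) ||
      (kBelow && (!jAbove && !jBelow))

/-- The order `(X_good, Y_bad, ck, cj, X_bad, Y_good)` built for a pivot `z`; here
`X_good = (∞; z; P) \ [cj; -∞; q)`, `X_bad = (∞; z; P) ∩ (cj; -∞; q)`,
`Y_good = [z; -∞; P) \ (∞; ck; q]` without `cj`, and `Y_bad = [z; -∞; P) ∩ (∞; ck; q)`, each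
ordered by `P`. -/
def buildT {m : ℕ} (P : List (Fin m)) (q : List (Fin m × Fin m)) (cj ck z : Fin m) :
    Timed (List (Fin m)) := do
  tick
  let X ← aboveT z P
  let Y ← fromT z P
  let xGood ← filterT (fun x => do
    let b ← memT (cj, x) q
    return !b && decide (x ≠ cj)) X
  let xBad ← filterT (fun x => memT (cj, x) q) X
  let yGood ← filterT (fun y => do
    let b ← memT (y, ck) q
    return !b && decide (y ≠ ck) && decide (y ≠ cj)) Y
  let yBad ← filterT (fun y => memT (y, ck) q) Y
  let t ← appendT yGood xBad
  let t ← appendT (ck :: cj :: t) yBad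
  appendT t xGood

/-- The main loop over the pivots, with state `d^abs`, `d^loc`, `P^loc`. -/
def loopT {m : ℕ} (P : List (Fin m)) (q : List (Fin m × Fin m)) (pw : List (Fin m))
    (cj ck : Fin m) (dabs dloc : WithTop ℕ) (Ploc : List (Fin m)) :
    List (Fin m) → Timed (List (Fin m))
  | [] => do
    tick
    return if dabs < dloc then P else Ploc
  | z :: Z => do
    tick
    let P' ← buildT P q cj ck z
    let d ← swapDistT P P'
    let b ← isLDT P P' pw
    let dabs' : WithTop ℕ := if (d : WithTop ℕ) < dabs then (d : WithTop ℕ) else dabs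
    if b ∧ (d : WithTop ℕ) < dloc then loopT P q pw cj ck dabs' (d : WithTop ℕ) P' Z
    else loopT P q pw cj ck dabs' dloc Ploc Z

/-- The voter manipulation meta-algorithm. Its input is the current order `P`, the closure `q` of
the responses given so far, the vector `pw` of possible winners and the query `cj`, `ck`; its
output is a preference order. -/
def metaAlgorithm {m : ℕ} (P : List (Fin m)) (q : List (Fin m × Fin m)) (pw : List (Fin m))
    (cj ck : Fin m) : Timed (List (Fin m)) := do
  tick
  let ok ← feasibleT P cj ck pw
  if ok then
    let t ← fromT cj P
    let Z ← uptoT ck t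
    loopT P q pw cj ck ⊤ ⊤ P Z
  else return P

end IterVoting

namespace IterVoting

/-! ## Orders -/

/-! Count losses instead of scores: the loss of a candidate on a ballot is the number of candidates
above it, and the winner has the least total loss. `gain P P' c` is the number of positions that `c`
climbs from `P` to `P'`. If only voter `i` changes ballot and the winner changes from `y` to `x`,
then `x` gains more than `y` (`gain_lt_of_winners`).

Shape of `mu`. Minimality forces each member to be `block P H`: a set `H` containing `ck` is lifted
above its complement, which contains `cj`, and nothing else moves (`exists_isCut_of_mem_mu`). Call a
candidate outside `H` free if it is not `cj` and not forced below `cj`, and one inside `H` free if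
it is not `ck` and not forced above `ck`. By an exchange argument no free outsider stands above a
free insider (`not_cross_of_mem_mu`), so one threshold `z` determines `H`
(`exists_pivot_of_mem_mu`), and `buildT_val` identifies the resulting order with the one that the
loop builds.

Meaning of the test. It says that gains weakly decrease along the possible winners in the order of
`P` and are not constant (`isLDT_iff`). With four voters it implies local dominance
(`locallyDominant_of_isLDT`), and for block orders it is implied by it (`isLDT_of_locallyDominant`).
Both directions need worlds with prescribed winners.

Worlds. In `exists_world_of_ballots` one voter cancels the ballot `F` of voter `i` on the set `W` of
possible winners. The responses of two more keep `z`, the last member of `W` in `F`, ahead of every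
outsider while every member of `W` can still win, so the announced set is unchanged. The remaining
voters split between `x` and `y` so that under `F` candidate `x` wins by a tie-break or by one
point; one position gained by `y` over `x` then reverses the outcome. The parity of the number of
voters decides whether the two special voters must treat `x` and `y` equally or with a margin of
one.

The loop therefore meets an order of minimal distance that passes the test, and `loopT_val` shows
that such an order is returned. The time bound adds up the routines on lists of length polynomial in
`m`. -/

theorem Pref.prefers_irrefl {m : ℕ} (P : Pref m) (a : Fin m) : ¬ P.prefers a a :=
  lt_irrefl _

theorem Pref.prefers.trans {m : ℕ} {P : Pref m} {a b c : Fin m} (h : P.prefers a b)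
    (h' : P.prefers b c) : P.prefers a c :=
  lt_trans h h'

theorem Pref.prefers.asymm {m : ℕ} {P : Pref m} {a b : Fin m} (h : P.prefers a b) :
    ¬ P.prefers b a :=
  lt_asymm h

theorem Pref.prefers.ne {m : ℕ} {P : Pref m} {a b : Fin m} (h : P.prefers a b) : a ≠ b := by
  rintro rfl; exact P.prefers_irrefl _ h

theorem Pref.idxOf_inj {m : ℕ} (P : Pref m) {a b : Fin m}
    (h : P.order.idxOf a = P.order.idxOf b) : a = b :=
  (List.idxOf_inj (P.complete a)).1 h

theorem Pref.prefers_or {m : ℕ} (P : Pref m) {a b : Fin m} (h : a ≠ b) :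
    P.prefers a b ∨ P.prefers b a :=
  lt_or_gt_of_ne fun h' => h (P.idxOf_inj h')

theorem Pref.not_prefers_iff {m : ℕ} (P : Pref m) {a b : Fin m} :
    ¬ P.prefers a b ↔ a = b ∨ P.prefers b a := by
  constructor
  · intro h
    by_cases hab : a = b
    · exact Or.inl hab
    · exact Or.inr ((P.prefers_or hab).resolve_left h)
  · rintro (rfl | h)
    · exact P.prefers_irrefl _
    · exact h.asymm

theorem Pref.length_order {m : ℕ} (P : Pref m) : P.order.length = m := by
  have h : P.order.toFinset = Finset.univ := by
    ext c; simp [P.complete c]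
  have h2 := List.toFinset_card_of_nodup P.nodup
  rw [h] at h2
  simpa using h2.symm

theorem Pref.idxOf_lt {m : ℕ} (P : Pref m) (a : Fin m) : P.order.idxOf a < m := by
  have := List.idxOf_lt_length_of_mem (P.complete a)
  rwa [P.length_order] at this

theorem Pref.pairwise_order {m : ℕ} (P : Pref m) : P.order.Pairwise P.prefers := by
  rw [List.pairwise_iff_getElem]
  intro i j hi hj hij
  unfold Pref.prefers
  rw [P.nodup.idxOf_getElem _ hi, P.nodup.idxOf_getElem _ hj]
  exact hij

/-- An asymmetric relation sorts the candidates in at most one way. This is how a list computed by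
the algorithm is recognised as a given order. -/
theorem Pref.order_eq_of_pairwise {m : ℕ} (P : Pref m) {l : List (Fin m)}
    {r : Fin m → Fin m → Prop} (hr : ∀ a b, r a b → ¬ r b a) (hP : P.order.Pairwise r)
    (hl : l.Pairwise r) (hmem : ∀ c, c ∈ l) : l = P.order := by
  have hnd : l.Nodup := hl.imp fun {a b} hab => by
    rintro rfl; exact hr _ _ hab hab
  have hperm : l.Perm P.order :=
    (List.perm_ext_iff_of_nodup hnd P.nodup).2 fun c => by simp [hmem c, P.complete c]
  exact hperm.eq_of_pairwise (fun a b _ _ h1 h2 => absurd h2 (hr _ _ h1)) hl hP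

theorem Pref.ext_prefers {m : ℕ} {P P' : Pref m}
    (h : ∀ a b, P.prefers a b → P'.prefers a b) : P = P' := by
  apply Pref.ext
  refine P'.order_eq_of_pairwise (r := P'.prefers) (fun a b h => h.asymm) P'.pairwise_order
    (P.pairwise_order.imp fun {a b} => h a b) P.complete

/-! ### Losses: positions counted from the top. -/

/-- The candidates that are ranked above `c`. -/
def above {m : ℕ} (P : Pref m) (c : Fin m) : Finset (Fin m) :=
  Finset.univ.filter fun d => P.prefers d c

@[simp] theorem mem_above {m : ℕ} {P : Pref m} {c d : Fin m} : d ∈ above P c ↔ P.prefers d c := by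
  simp [above]

/-- The number of candidates ranked above `c`. -/
abbrev loss {m : ℕ} (P : Pref m) (c : Fin m) : ℕ := P.order.idxOf c

/-- Losses take each value below `m` exactly once, so candidates can be counted by counting numbers.
-/
theorem card_filter_loss {m : ℕ} (P : Pref m) (p : ℕ → Prop) [DecidablePred p] :
    (Finset.univ.filter fun d => p (loss P d)).card = ((Finset.range m).filter p).card := by
  refine Finset.card_bij (fun d _ => loss P d) ?_ ?_ ?_
  · intro a ha
    simp only [Finset.mem_filter, Finset.mem_univ, true_and, Finset.mem_range] at ha ⊢
    exact ⟨P.idxOf_lt a, ha⟩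
  · intro a _ b _ h
    exact P.idxOf_inj h
  · intro k hk
    simp only [Finset.mem_filter, Finset.mem_range] at hk
    have hk' : k < P.order.length := by rw [P.length_order]; exact hk.1
    refine ⟨P.order[k], ?_, P.nodup.idxOf_getElem _ hk'⟩
    simp only [Finset.mem_filter, Finset.mem_univ, true_and]
    rw [show loss P P.order[k] = k from P.nodup.idxOf_getElem _ hk']
    exact hk.2

theorem loss_eq_card {m : ℕ} (P : Pref m) (c : Fin m) : loss P c = (above P c).card := by
  have h := card_filter_loss P (fun k => k < loss P c)
  have h2 : (Finset.range m).filter (fun k => k < loss P c) = Finset.range (loss P c) := by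
    ext k
    have := P.idxOf_lt c
    simp only [Finset.mem_filter, Finset.mem_range]
    exact ⟨fun h => h.2, fun h => ⟨h.trans this, h⟩⟩
  rw [h2, Finset.card_range] at h
  exact h.symm

theorem le_loss {m : ℕ} {P : Pref m} {c : Fin m} (s : Finset (Fin m))
    (h : ∀ d ∈ s, P.prefers d c) : s.card ≤ loss P c := by
  rw [loss_eq_card]
  exact Finset.card_le_card fun d hd => mem_above.2 (h d hd)

theorem loss_le {m : ℕ} {P : Pref m} {c : Fin m} (s : Finset (Fin m))
    (h : ∀ d, P.prefers d c → d ∈ s) : loss P c ≤ s.card := by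
  rw [loss_eq_card]
  exact Finset.card_le_card fun d hd => h d (mem_above.1 hd)

/-- The largest total score becomes the least total loss, which is easier to control when ballots
are prescribed from the top. -/
theorem score_add_loss {m : ℕ} (P : Pref m) (c : Fin m) : score P c + loss P c = m := by
  have h := card_filter_loss P (fun k => loss P c < k)
  have h2 : (Finset.range m).filter (fun k => loss P c < k) = Finset.Ioo (loss P c) m := by
    ext k
    simp [and_comm]
  rw [h2, Nat.card_Ioo] at h
  have h3 : score P c = 1 + (Finset.univ.filter fun d => loss P c < loss P d).card := rfl
  rw [h3, h]
  have : loss P c < m := P.idxOf_lt c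
  omega

theorem pairwise_of_idxOf_lt {α : Type*} [DecidableEq α] {r : α → α → Prop} {l : List α}
    (hl : l.Pairwise r) {a b : α} (hb : b ∈ l) (h : l.idxOf a < l.idxOf b) : r a b := by
  have hb' := List.idxOf_lt_length_of_mem hb
  have := List.pairwise_iff_getElem.1 hl _ _ (h.trans hb') hb' h
  simpa using this

/-! ### Orders given by keys, levels and blocks. -/

/-- The order that sorts the candidates by increasing `f`. -/
def ofKey {m : ℕ} (f : Fin m → ℕ) : Pref m where
  order := (List.finRange m).insertionSort fun a b => f a ≤ f b
  nodup := (List.perm_insertionSort _ _).nodup_iff.2 (List.nodup_finRange m)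
  complete c := (List.perm_insertionSort _ _).mem_iff.2 (List.mem_finRange c)

theorem ofKey_prefers {m : ℕ} {f : Fin m → ℕ} (hf : Function.Injective f) {a b : Fin m} :
    (ofKey f).prefers a b ↔ f a < f b := by
  have key : ∀ a b, (ofKey f).prefers a b → f a < f b := by
    intro a b h
    have : Std.Total (fun a b : Fin m => f a ≤ f b) := ⟨fun a b => le_total _ _⟩
    have : IsTrans (Fin m) (fun a b : Fin m => f a ≤ f b) := ⟨fun a b c => le_trans⟩
    have hs := List.pairwise_insertionSort (fun a b : Fin m => f a ≤ f b) (List.finRange m)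
    have h1 : f a ≤ f b := pairwise_of_idxOf_lt hs ((ofKey f).complete b) h
    exact lt_of_le_of_ne h1 fun h2 => h.ne (hf h2)
  refine ⟨key a b, fun h => ?_⟩
  by_contra hn
  rcases (ofKey f).not_prefers_iff.1 hn with rfl | h'
  · exact lt_irrefl _ h
  · exact lt_asymm h (key _ _ h')

/-- The order that sorts the candidates by level `f`, and by `N` within a level. -/
def lev {m : ℕ} (f : Fin m → ℕ) (N : Pref m) : Pref m :=
  -- Losses are below `m`, so this key is lexicographic.
  ofKey fun c => f c * m + loss N c

theorem lev_prefers {m : ℕ} {f : Fin m → ℕ} {N : Pref m} {a b : Fin m} :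
    (lev f N).prefers a b ↔ f a < f b ∨ (f a = f b ∧ N.prefers a b) := by
  have key : ∀ a b, f a < f b → f a * m + loss N a < f b * m + loss N b := by
    intro a b h
    have h1 := N.idxOf_lt a
    have h2 : (f a + 1) * m ≤ f b * m := Nat.mul_le_mul_right _ h
    rw [add_mul, one_mul] at h2
    have : loss N a < m := h1
    omega
  have hinj : Function.Injective fun c => f c * m + loss N c := by
    intro a b h
    simp only at h
    rcases lt_trichotomy (f a) (f b) with h' | h' | h'
    · have := key _ _ h'; omega
    · rw [h'] at h; exact N.idxOf_inj (Nat.add_left_cancel h)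
    · have := key _ _ h'; omega
  rw [lev, ofKey_prefers hinj]
  rcases lt_trichotomy (f a) (f b) with h' | h' | h'
  · simp [h', key _ _ h']
  · simp only [h', lt_irrefl, false_or, true_and, add_lt_add_iff_left]; rfl
  · have := key _ _ h'
    constructor
    · intro h; omega
    · rintro (h | h) <;> omega

theorem lev_of_lt {m : ℕ} {f : Fin m → ℕ} {N : Pref m} {a b : Fin m} (h : f a < f b) :
    (lev f N).prefers a b :=
  lev_prefers.2 (Or.inl h)

theorem lev_of_eq {m : ℕ} {f : Fin m → ℕ} {N : Pref m} {a b : Fin m} (h : f a = f b)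
    (h' : N.prefers a b) : (lev f N).prefers a b :=
  lev_prefers.2 (Or.inr ⟨h, h'⟩)

theorem le_of_lev {m : ℕ} {f : Fin m → ℕ} {N : Pref m} {a b : Fin m}
    (h : (lev f N).prefers a b) : f a ≤ f b := by
  rcases lev_prefers.1 h with h | h
  · exact h.le
  · exact h.1.le

/-- The reversed order. -/
def Pref.rev {m : ℕ} (P : Pref m) : Pref m := ofKey fun c => m - loss P c

theorem rev_prefers {m : ℕ} {P : Pref m} {a b : Fin m} : P.rev.prefers a b ↔ P.prefers b a := by
  have hinj : Function.Injective fun c => m - loss P c := by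
    intro a b h
    have h1 : loss P a < m := P.idxOf_lt a
    have h2 : loss P b < m := P.idxOf_lt b
    exact P.idxOf_inj (by simp only at h; unfold loss at *; omega)
  have h1 : loss P a < m := P.idxOf_lt a
  have h2 : loss P b < m := P.idxOf_lt b
  rw [Pref.rev, ofKey_prefers hinj]
  unfold Pref.prefers loss at *
  omega

open Classical in
/-- The members of `S` in the order of `P`, followed by the other candidates in the order of
`P`. -/
noncomputable def block {m : ℕ} (P : Pref m) (S : Set (Fin m)) : Pref m :=
  lev (fun c => if c ∈ S then 0 else 1) P

theorem block_prefers {m : ℕ} {P : Pref m} {S : Set (Fin m)} {a b : Fin m} :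
    (block P S).prefers a b ↔ (a ∈ S ∧ b ∉ S) ∨ ((a ∈ S ↔ b ∈ S) ∧ P.prefers a b) := by
  classical
  rw [block, lev_prefers]
  by_cases ha : a ∈ S <;> by_cases hb : b ∈ S <;> simp [ha, hb]

/-! ## Responses -/

theorem models_iff {m : ℕ} {P : Pref m} {Q : Responses m} :
    Models P Q ↔ ∀ a b, (a, b) ∈ Q → P.prefers a b := by
  constructor
  · intro h a b hab
    exact h a b (Relation.TransGen.single hab)
  · intro h a b hab
    have hab' : Relation.TransGen (fun a b => (a, b) ∈ Q) a b := hab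
    clear hab
    induction hab' with
    | single h1 => exact h _ _ h1
    | tail _ h1 ih => exact ih.trans (h _ _ h1)

theorem subset_CL {m : ℕ} {Q : Responses m} {p : Fin m × Fin m} (h : p ∈ Q) : p ∈ CL Q :=
  Relation.TransGen.single (by simpa using h)

theorem CL_trans {m : ℕ} {Q : Responses m} {a b c : Fin m} (h : (a, b) ∈ CL Q)
    (h' : (b, c) ∈ CL Q) : (a, c) ∈ CL Q :=
  Relation.TransGen.trans h h'

theorem Models.mono {m : ℕ} {P : Pref m} {Q Q' : Responses m} (h : Models P Q') (hQ : Q ⊆ Q') :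
    Models P Q :=
  models_iff.2 fun a b hab => models_iff.1 h a b (hQ hab)

/-! ## Winners in terms of losses -/

/-- The total loss of a candidate. -/
def totalLoss {n m : ℕ} (R : Fin n → Pref m) (c : Fin m) : ℕ := ∑ v, loss (R v) c

theorem totalScore_add_totalLoss {n m : ℕ} (R : Fin n → Pref m) (c : Fin m) :
    totalScore R c + totalLoss R c = n * m := by
  unfold totalScore totalLoss
  rw [← Finset.sum_add_distrib]
  simp [score_add_loss]

theorem isWinner_iff {n m : ℕ} {T : Pref m} {R : Fin n → Pref m} {c : Fin m} :
    IsWinner T R c ↔ ∀ c', c' ≠ c → totalLoss R c < totalLoss R c' ∨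
      (totalLoss R c = totalLoss R c' ∧ T.prefers c c') := by
  unfold IsWinner
  refine forall_congr' fun c' => imp_congr_right fun _ => ?_
  have h1 := totalScore_add_totalLoss R c
  have h2 := totalScore_add_totalLoss R c'
  refine or_congr (by omega) (and_congr_left fun _ => by omega)

theorem totalLoss_update {n m : ℕ} (R : Fin n → Pref m) (i : Fin n) (F : Pref m) (c : Fin m) :
    totalLoss (Function.update R i F) c =
      loss F c + ∑ v ∈ Finset.univ.erase i, loss (R v) c := by
  unfold totalLoss
  rw [← Finset.add_sum_erase _ _ (Finset.mem_univ i), Function.update_self]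
  congr 1
  refine Finset.sum_congr rfl fun v hv => ?_
  rw [Function.update_of_ne (Finset.ne_of_mem_erase hv)]

theorem IsPossibleWorld.winner_mem {n m : ℕ} {T : Pref m} {Q : Fin n → Responses m} {i : Fin n}
    {R : Fin n → Pref m} (hR : IsPossibleWorld T Q i R) {F : Pref m} (hF : Models F (Q i))
    {x : Fin m} (hx : IsWinner T (Function.update R i F) x) : x ∈ possibleWinners T Q := by
  obtain ⟨Q', hi, hv, hPW⟩ := hR
  rw [← hPW]
  refine ⟨_, fun v => ?_, hx⟩
  by_cases h : v = i
  · subst h; rw [Function.update_self, hi]; exact hF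
  · rw [Function.update_of_ne h]; exact hv v h

/-! ## Minimal swap distance -/

/-- Swap distance is the size of the inversion set, and an order is determined by its inversions
relative to `P`. Inclusion one way and comparison of sizes the other way give equality. -/
theorem eq_of_swapDist_le {m : ℕ} {P P' P'' : Pref m}
    (h : ∀ a b, P.prefers a b → P''.prefers b a → P'.prefers b a)
    (hle : swapDist P P' ≤ swapDist P P'') : P' = P'' := by
  have hsub : (Finset.univ.filter
      (fun p : Fin m × Fin m => P.prefers p.1 p.2 ∧ P''.prefers p.2 p.1)) ⊆
      (Finset.univ.filter
      (fun p : Fin m × Fin m => P.prefers p.1 p.2 ∧ P'.prefers p.2 p.1)) := by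
    intro p hp
    simp only [Finset.mem_filter, Finset.mem_univ, true_and] at hp ⊢
    exact ⟨hp.1, h _ _ hp.1 hp.2⟩
  have heq := Finset.eq_of_subset_of_card_le hsub hle
  have hback : ∀ a b, P.prefers a b → P'.prefers b a → P''.prefers b a := by
    intro a b hab hba
    have : (a, b) ∈ (Finset.univ.filter
      (fun p : Fin m × Fin m => P.prefers p.1 p.2 ∧ P''.prefers p.2 p.1)) := by
      rw [heq]; simp [hab, hba]
    simp only [Finset.mem_filter, Finset.mem_univ, true_and] at this
    exact this.2
  refine Pref.ext_prefers fun a b hab => ?_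
  rcases P.prefers_or hab.ne with hP | hP
  · rcases P''.prefers_or hab.ne with h'' | h''
    · exact h''
    · exact absurd (h _ _ hP h'') hab.asymm
  · exact hback _ _ hP hab

theorem block_models {m : ℕ} {P : Pref m} {Q : Responses m} {cj ck : Fin m} {S : Set (Fin m)}
    (hP : Models P Q) (hS : ∀ a b, (a, b) ∈ CL Q → b ∈ S → a ∈ S) (hck : ck ∈ S)
    (hcj : cj ∉ S) : Models (block P S) (Q ∪ {(ck, cj)}) := by
  rw [models_iff]
  rintro a b (hab | hab)
  · have h1 := hS a b (subset_CL hab)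
    have h2 := models_iff.1 hP a b hab
    rw [block_prefers]
    tauto
  · obtain ⟨rfl, rfl⟩ : a = ck ∧ b = cj := by simpa using hab
    exact block_prefers.2 (Or.inl ⟨hck, hcj⟩)

/-- Restoring the order of `P` inside an upper set `S` of `P'` and inside its complement only
removes inversions and stays consistent. A minimal order therefore already has this form, for every
admissible `S`. -/
theorem eq_block_of_mem_mu {m : ℕ} {P P' : Pref m} {Q : Responses m} {cj ck : Fin m}
    (hP : Models P Q) (hmu : P' ∈ mu Q P cj ck) {S : Set (Fin m)}
    (hS : ∀ a b, P'.prefers a b → b ∈ S → a ∈ S) (hck : ck ∈ S) (hcj : cj ∉ S) :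
    P' = block P S := by
  have hQ : Models P' Q := hmu.1.mono Set.subset_union_left
  refine eq_of_swapDist_le (P := P) ?_
    (hmu.2 _ (block_models hP (fun a b hab => hS a b (hQ a b hab)) hck hcj))
  intro a b hab hba
  rcases block_prefers.1 hba with ⟨hb, ha⟩ | ⟨_, h⟩
  · by_contra hn
    rcases P'.not_prefers_iff.1 hn with rfl | h'
    · exact hab.ne rfl
    · exact ha (hS _ _ h' hb)
  · exact absurd h hab.asymm

/-- The shape of the orders of minimal swap distance: a set `H` containing `ck` is moved above the
rest, which contains `cj`. -/
structure IsCut {m : ℕ} (P : Pref m) (Q : Responses m) (cj ck : Fin m) (H : Set (Fin m)) :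
    Prop where
  mem : ck ∈ H
  notMem : cj ∉ H
  closed : ∀ a b, (a, b) ∈ CL Q → b ∈ H → a ∈ H
  upper : ∀ c ∈ H, c = ck ∨ P.prefers c ck
  lower : ∀ c ∉ H, c = cj ∨ P.prefers cj c

theorem exists_isCut_of_mem_mu {m : ℕ} {P P' : Pref m} {Q : Responses m} {cj ck : Fin m}
    (hP : Models P Q) (hjk : P.prefers cj ck) (hmu : P' ∈ mu Q P cj ck) :
    ∃ H, IsCut P Q cj ck H ∧ P' = block P H := by
  have hkj : P'.prefers ck cj := models_iff.1 hmu.1 ck cj (Or.inr rfl)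
  have hQ : Models P' Q := hmu.1.mono Set.subset_union_left
  set H : Set (Fin m) := {c | P'.prefers c cj} with hH
  set H2 : Set (Fin m) := {c | c = ck ∨ P'.prefers c ck} with hH2
  have hcj2 : cj ∉ H2 := by
    rintro (h | h)
    · exact hjk.ne h
    · exact h.asymm hkj
  have e1 : P' = block P H := eq_block_of_mem_mu hP hmu
    (fun a b h h' => Pref.prefers.trans h h') hkj (P'.prefers_irrefl _)
  have e2 : P' = block P H2 := by
    refine eq_block_of_mem_mu hP hmu ?_ (Or.inl rfl) hcj2
    rintro a b h (rfl | h')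
    · exact Or.inr h
    · exact Or.inr (h.trans h')
  -- A candidate strictly between `ck` and `cj` in `P'` would be below `ck` in `P` by `e1` and above
  -- `cj` by `e2`, against `cj ≻ ck`. So the two block forms coincide.
  have hle : ∀ c ∈ H, c = ck ∨ P'.prefers c ck := by
    intro c hc
    by_contra hn
    have hc2 : c ∉ H2 := hn
    push Not at hn
    have h1 : P'.prefers ck c := (P'.prefers_or hn.1).resolve_left hn.2
    have h2 : P.prefers ck c := by
      rw [e1, block_prefers] at h1
      rcases h1 with h1 | h1
      · exact absurd hc h1.2
      · exact h1.2
    have h3 : P.prefers c cj := by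
      have hc' : P'.prefers c cj := hc
      rw [e2, block_prefers] at hc'
      rcases hc' with h1 | h1
      · exact absurd h1.1 hc2
      · exact h1.2
    exact (h2.trans h3).asymm hjk
  refine ⟨H, ⟨hkj, P'.prefers_irrefl _, fun a b hab hb => Pref.prefers.trans (hQ a b hab) hb,
    ?_, ?_⟩, e1⟩
  · intro c hc
    rcases hle c hc with h | h
    · exact Or.inl h
    · rw [e1, block_prefers] at h
      rcases h with h | h
      · exact absurd hkj h.2
      · exact Or.inr h.2
  · intro c hc
    rcases P'.not_prefers_iff.1 hc with h | h
    · exact Or.inl h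
    · have h' := h
      rw [e1, block_prefers] at h
      rcases h with h | h
      · exact absurd h.1 (P'.prefers_irrefl _)
      · exact Or.inr h.2

/-- The inversions of `block P S` are the pairs with a nonmember of `S` above a member in `P`. The
transposition of `l` and `h` carries the exchanged set to `S` and injects its inversions into those
of `S`, missing `(l, h)`. -/
theorem swapDist_block_exchange_lt {m : ℕ} {P : Pref m} {S : Set (Fin m)} {l h : Fin m}
    (hl : l ∉ S) (hh : h ∈ S) (hlh : P.prefers l h) :
    swapDist P (block P ((S ∪ {l}) \ {h})) < swapDist P (block P S) := by
  classical
  have hne : l ≠ h := hlh.ne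
  set S' : Set (Fin m) := (S ∪ {l}) \ {h} with hS'
  have hS'mem : ∀ c, c ∈ S' ↔ Equiv.swap l h c ∈ S := by
    intro c
    by_cases h1 : c = l
    · subst h1; simp [hS', hh, hne]
    by_cases h2 : c = h
    · subst h2; simp [hS', hl]
    · rw [Equiv.swap_apply_of_ne_of_ne h1 h2]; simp [hS', h1, h2]
  have hinv : ∀ (U : Set (Fin m)) (a b : Fin m), P.prefers a b ∧ (block P U).prefers b a ↔
      P.prefers a b ∧ b ∈ U ∧ a ∉ U := by
    intro U a b
    rw [block_prefers]
    refine and_congr_right fun hab => ?_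
    have := hab.asymm
    tauto
  have hcross : (l, h) ∈ (Finset.univ.filter
      (fun p : Fin m × Fin m => P.prefers p.1 p.2 ∧ (block P S).prefers p.2 p.1)) := by
    simp only [Finset.mem_filter, Finset.mem_univ, true_and]
    rw [hinv]
    exact ⟨hlh, hh, hl⟩
  have hle : swapDist P (block P S') ≤ ((Finset.univ.filter
      (fun p : Fin m × Fin m => P.prefers p.1 p.2 ∧ (block P S).prefers p.2 p.1)).erase
        (l, h)).card := by
    unfold swapDist
    refine Finset.card_le_card_of_injOn (fun p => (Equiv.swap l h p.1, Equiv.swap l h p.2)) ?_ ?_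
    · rintro ⟨a, b⟩ hp
      simp only [Finset.coe_filter, Finset.mem_univ, true_and, Set.mem_ofPred_eq] at hp
      rw [hinv, hS'mem, hS'mem] at hp
      obtain ⟨hab, hb, ha⟩ := hp
      simp only [Finset.coe_erase, Finset.coe_filter, Finset.mem_univ, true_and, Set.mem_sdiff,
        Set.mem_ofPred_eq, Set.mem_singleton_iff, Prod.mk.injEq]
      rw [hinv]
      have hal : a ≠ l := by rintro rfl; simp [hh] at ha
      have hbh : b ≠ h := by rintro rfl; simp [hl] at hb
      refine ⟨⟨?_, hb, ha⟩, ?_⟩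
      · by_cases hah : a = h <;> by_cases hbl : b = l
        · subst hah hbl; exact absurd hab hlh.asymm
        · subst hah
          rw [Equiv.swap_apply_right, Equiv.swap_apply_of_ne_of_ne hbl hbh]
          exact hlh.trans hab
        · subst hbl
          rw [Equiv.swap_apply_left, Equiv.swap_apply_of_ne_of_ne hal hah]
          exact hab.trans hlh
        · rw [Equiv.swap_apply_of_ne_of_ne hal hah, Equiv.swap_apply_of_ne_of_ne hbl hbh]
          exact hab
      · rintro ⟨h1, h2⟩
        rw [Equiv.swap_apply_eq_iff, Equiv.swap_apply_left] at h1
        rw [Equiv.swap_apply_eq_iff, Equiv.swap_apply_right] at h2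
        subst h1 h2
        exact hlh.asymm hab
    · rintro ⟨a, b⟩ _ ⟨c, d⟩ _ hh
      simpa using hh
  rw [Finset.card_erase_of_mem hcross] at hle
  have hpos : 0 < (Finset.univ.filter
      (fun p : Fin m × Fin m => P.prefers p.1 p.2 ∧ (block P S).prefers p.2 p.1)).card :=
    Finset.card_pos.2 ⟨_, hcross⟩
  have : swapDist P (block P S) = (Finset.univ.filter
      (fun p : Fin m × Fin m => P.prefers p.1 p.2 ∧ (block P S).prefers p.2 p.1)).card := rfl
  omega

/-- The first of the candidates with property `p`. -/
theorem Pref.exists_first {m : ℕ} (P : Pref m) {p : Fin m → Prop} (h : ∃ c, p c) :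
    ∃ c, p c ∧ ∀ d, p d → d = c ∨ P.prefers c d := by
  classical
  obtain ⟨c0, hc0⟩ := h
  obtain ⟨c, hc, hmin⟩ := (Finset.univ.filter p).exists_min_image (fun c => loss P c)
    ⟨c0, by simpa using hc0⟩
  refine ⟨c, by simpa using hc, fun d hd => ?_⟩
  have h1 := hmin d (by simpa using hd)
  by_cases hdc : d = c
  · exact Or.inl hdc
  · exact Or.inr ((P.prefers_or (Ne.symm hdc)).resolve_right (not_lt.2 h1))

/-- The last of the candidates with property `p`. -/
theorem Pref.exists_last {m : ℕ} (P : Pref m) {p : Fin m → Prop} (h : ∃ c, p c) :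
    ∃ c, p c ∧ ∀ d, p d → d = c ∨ P.prefers d c := by
  obtain ⟨c, hc, h⟩ := P.rev.exists_first h
  exact ⟨c, hc, fun d hd => by simpa [rev_prefers] using h d hd⟩

/-- Otherwise an exchange would shorten the distance. It is made between the first free outsider and
the last free insider: a response placing an outsider above the former, or a member of `H` below the
latter, would lead to an earlier or a later free candidate, so the exchanged set is still closed. -/
theorem not_cross_of_mem_mu {m : ℕ} {P : Pref m} {Q : Responses m} {cj ck : Fin m}
    {H : Set (Fin m)} (hP : Models P Q) (hH : IsCut P Q cj ck H)
    (hmu : block P H ∈ mu Q P cj ck) {l h : Fin m} (hl : l ∉ H) (hlj : l ≠ cj)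
    (hjl : (cj, l) ∉ CL Q) (hh : h ∈ H) (hhk : h ≠ ck) (hkh : (h, ck) ∉ CL Q) :
    ¬ P.prefers l h := by
  intro hlh
  obtain ⟨l', ⟨hl1, hl2, hl3⟩, hl4⟩ := P.exists_first
    (p := fun l => l ∉ H ∧ l ≠ cj ∧ (cj, l) ∉ CL Q) ⟨l, hl, hlj, hjl⟩
  obtain ⟨h', ⟨hh1, hh2, hh3⟩, hh4⟩ := P.exists_last
    (p := fun h => h ∈ H ∧ h ≠ ck ∧ (h, ck) ∉ CL Q) ⟨h, hh, hhk, hkh⟩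
  have hlh' : P.prefers l' h' := by
    rcases hl4 l ⟨hl, hlj, hjl⟩ with rfl | h1 <;> rcases hh4 h ⟨hh, hhk, hkh⟩ with rfl | h2
    · exact hlh
    · exact hlh.trans h2
    · exact h1.trans hlh
    · exact (h1.trans hlh).trans h2
  have hlt := swapDist_block_exchange_lt hl1 hh1 hlh'
  refine absurd (hmu.2 _ (block_models hP ?_ ?_ ?_)) (not_le.2 hlt)
  · rintro a b hab ⟨hb, hbh⟩
    have hPab := hP a b hab
    simp only [Set.mem_singleton_iff] at hbh
    rcases hb with hb | hb
    · refine ⟨Or.inl (hH.closed a b hab hb), ?_⟩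
      rintro rfl
      by_cases hbk : b = ck
      · subst hbk; exact hh3 hab
      · rcases hh4 b ⟨hb, hbk, fun hbk => hh3 (CL_trans hab hbk)⟩ with rfl | h1
        · exact hbh rfl
        · exact h1.asymm hPab
    · obtain rfl : b = l' := hb
      refine ⟨Or.inl ?_, ?_⟩
      · by_contra ha
        by_cases haj : a = cj
        · subst haj; exact hl3 hab
        · rcases hl4 a ⟨ha, haj, fun hja => hl3 (CL_trans hja hab)⟩ with rfl | h1
          · exact hPab.ne rfl
          · exact h1.asymm hPab
      · rintro rfl
        exact hlh'.asymm hPab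
  · exact ⟨Or.inl hH.mem, fun h => hh2 h.symm⟩
  · rintro ⟨h | h, _⟩
    · exact hH.notMem h
    · exact hl2 h.symm

/-! ### Pivots. -/

/-- The upper part `X_good, Y_bad, ck` of the order built for the pivot `z`. -/
def pivotSet {m : ℕ} (P : Pref m) (Q : Responses m) (cj ck z : Fin m) : Set (Fin m) :=
  {c | (P.prefers c z ∧ (cj, c) ∉ CL Q ∧ c ≠ cj) ∨
    (¬ P.prefers c z ∧ ((c, ck) ∈ CL Q ∨ c = ck))}

/-- The pivot is the first free outsider above `ck`, or `ck` if there is none. Above it every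
candidate not barred by `cj` lies in `H`; from it on, only `ck` and what is forced above `ck` can
lie in `H`. -/
theorem exists_pivot_of_mem_mu {m : ℕ} {P P' : Pref m} {Q : Responses m} {cj ck : Fin m}
    (hP : Models P Q) (hjk : P.prefers cj ck) (hmu : P' ∈ mu Q P cj ck) :
    ∃ z, (z = cj ∨ P.prefers cj z) ∧ (z = ck ∨ P.prefers z ck) ∧
      P' = block P (pivotSet P Q cj ck z) := by
  obtain ⟨H, hH, rfl⟩ := exists_isCut_of_mem_mu hP hjk hmu
  have hjH : ∀ c ∈ H, (cj, c) ∉ CL Q ∧ c ≠ cj := fun c hc =>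
    ⟨fun h => hH.notMem (hH.closed _ _ h hc), fun h => hH.notMem (h ▸ hc)⟩
  have hkH : ∀ c, (c, ck) ∈ CL Q ∨ c = ck → c ∈ H := by
    rintro c (h | rfl)
    · exact hH.closed _ _ h hH.mem
    · exact hH.mem
  by_cases hex : ∃ l, l ∉ H ∧ l ≠ cj ∧ (cj, l) ∉ CL Q ∧ P.prefers l ck
  · obtain ⟨z, ⟨hz1, hz2, hz3, hz4⟩, hz5⟩ := P.exists_first hex
    refine ⟨z, Or.inr ((hH.lower z hz1).resolve_left hz2), Or.inr hz4, ?_⟩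
    congr 1
    ext c
    by_cases hcz : P.prefers c z
    · simp only [pivotSet, Set.mem_ofPred_eq, hcz, true_and, not_true, false_and, or_false]
      refine ⟨hjH c, fun ⟨h1, h2⟩ => ?_⟩
      by_contra hc
      rcases hz5 c ⟨hc, h2, h1, hcz.trans hz4⟩ with rfl | h
      · exact hcz.ne rfl
      · exact h.asymm hcz
    · simp only [pivotSet, Set.mem_ofPred_eq, hcz, false_and, not_false_eq_true, true_and,
        false_or]
      refine ⟨fun hc => ?_, hkH c⟩
      by_contra hn
      push Not at hn
      rcases P.not_prefers_iff.1 hcz with rfl | h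
      · exact hz1 hc
      · exact not_cross_of_mem_mu hP hH hmu hz1 hz2 hz3 hc hn.2 hn.1 h
  · refine ⟨ck, Or.inr hjk, Or.inl rfl, ?_⟩
    congr 1
    ext c
    by_cases hck : P.prefers c ck
    · simp only [pivotSet, Set.mem_ofPred_eq, hck, true_and, not_true, false_and, or_false]
      refine ⟨hjH c, fun ⟨h1, h2⟩ => ?_⟩
      by_contra hc
      exact hex ⟨c, hc, h2, h1, hck⟩
    · simp only [pivotSet, Set.mem_ofPred_eq, hck, false_and, not_false_eq_true, true_and,
        false_or]
      exact ⟨fun hc => Or.inr ((hH.upper c hc).resolve_right hck), hkH c⟩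

/-- All pivot orders are consistent, not only the minimal ones, so no distance met in the loop falls
below the minimum. As `cj ≻ ck` is not forced, nothing is forced both below `cj` and above `ck`. -/
theorem pivot_models {m : ℕ} {P : Pref m} {Q : Responses m} {cj ck z : Fin m}
    (hP : Models P Q) (hjk : P.prefers cj ck) (hq : (cj, ck) ∉ CL Q)
    (hz : z = cj ∨ P.prefers cj z) (hz' : z = ck ∨ P.prefers z ck) :
    Models (block P (pivotSet P Q cj ck z)) (Q ∪ {(ck, cj)}) := by
  refine block_models hP ?_ ?_ ?_
  · intro a b hab hb
    have hPab := hP a b hab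
    rcases hb with ⟨hb1, hb2, hb3⟩ | ⟨hb1, hb2⟩
    · refine Or.inl ⟨hPab.trans hb1, fun h => hb2 (CL_trans h hab), ?_⟩
      rintro rfl; exact hb2 hab
    · have hak : (a, ck) ∈ CL Q := by
        rcases hb2 with h | rfl
        · exact CL_trans hab h
        · exact hab
      by_cases haz : P.prefers a z
      · refine Or.inl ⟨haz, fun h => hq (CL_trans h hak), ?_⟩
        rintro rfl; exact hq hak
      · exact Or.inr ⟨haz, Or.inl hak⟩
  · refine Or.inr ⟨?_, Or.inr rfl⟩
    rcases hz' with rfl | h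
    · exact P.prefers_irrefl _
    · exact h.asymm
  · rintro (⟨_, _, h⟩ | ⟨_, h | h⟩)
    · exact h rfl
    · exact hq h
    · exact hjk.ne h

/-! ## Values of the routines -/

@[simp] theorem Timed.val_bind {α β : Type} (x : Timed α) (f : α → Timed β) :
    (x >>= f).val = (f x.val).val := rfl

@[simp] theorem Timed.time_bind {α β : Type} (x : Timed α) (f : α → Timed β) :
    (x >>= f).time = x.time + (f x.val).time := rfl

@[simp] theorem Timed.val_pure {α : Type} (a : α) : (pure a : Timed α).val = a := rfl

@[simp] theorem Timed.time_pure {α : Type} (a : α) : (pure a : Timed α).time = 0 := rfl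

@[simp] theorem time_tick : tick.time = 1 := rfl

theorem memT_val {m : ℕ} (p : Fin m × Fin m) (l : List (Fin m × Fin m)) :
    (memT p l).val = decide (p ∈ l) := by
  induction l with
  | nil => simp [memT]
  | cons x l ih =>
    simp only [memT, Timed.val_bind]
    split_ifs with h
    · have : x = p := Prod.ext h.1 h.2
      simp [this]
    · have : p ≠ x := fun h' => h (by simp [h'])
      simp [ih, this]

theorem indexT_val {m : ℕ} (c : Fin m) (l : List (Fin m)) : (indexT c l).val = l.idxOf c := by
  induction l with
  | nil => simp [indexT]
  | cons x l ih =>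
    simp only [indexT, Timed.val_bind]
    split_ifs with h
    · simp [h]
    · simp [ih, List.idxOf_cons_ne _ h]

theorem beforeT_val {m : ℕ} (a b : Fin m) (P : Pref m) :
    (beforeT a b P.order).val = decide (P.prefers a b) := by
  simp only [beforeT, Timed.val_bind, indexT_val, Timed.val_pure]
  exact decide_eq_decide.2 Iff.rfl

theorem lastT_val {m : ℕ} (a : Fin m) (l : List (Fin m)) :
    (lastT a l).val = (a :: l).getLast (List.cons_ne_nil a l) := by
  induction l generalizing a with
  | nil => simp [lastT]
  | cons b l ih => simp [lastT, ih]

section intervals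

variable {m : ℕ} {r : Fin m → Fin m → Prop}

theorem mem_aboveT {z : Fin m} {l : List (Fin m)} (hr : ∀ a b, r a b → ¬ r b a)
    (hl : l.Pairwise r) (hz : z ∈ l) {c : Fin m} :
    c ∈ (aboveT z l).val ↔ c ∈ l ∧ r c z := by
  induction l with
  | nil => simp at hz
  | cons x l ih =>
    rw [List.pairwise_cons] at hl
    simp only [aboveT, Timed.val_bind]
    split_ifs with h
    · subst h
      simp only [Timed.val_pure, List.not_mem_nil, List.mem_cons, false_iff, not_and]
      rintro (rfl | hc)
      · exact fun h => hr _ _ h h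
      · exact hr _ _ (hl.1 c hc)
    · have hz' : z ∈ l := by simpa [Ne.symm h] using hz
      have hxz := hl.1 z hz'
      simp only [Timed.val_pure, Timed.val_bind, List.mem_cons, ih hl.2 hz']
      constructor
      · rintro (rfl | h)
        · exact ⟨Or.inl rfl, hxz⟩
        · exact ⟨Or.inr h.1, h.2⟩
      · tauto

theorem mem_fromT {z : Fin m} {l : List (Fin m)} (hr : ∀ a b, r a b → ¬ r b a)
    (hl : l.Pairwise r) (hz : z ∈ l) {c : Fin m} :
    c ∈ (fromT z l).val ↔ c ∈ l ∧ (c = z ∨ r z c) := by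
  induction l with
  | nil => simp at hz
  | cons x l ih =>
    rw [List.pairwise_cons] at hl
    simp only [fromT, Timed.val_bind]
    split_ifs with h
    · subst h
      simp only [Timed.val_pure, List.mem_cons]
      have := hl.1 c
      tauto
    · have hz' : z ∈ l := by simpa [Ne.symm h] using hz
      have hxz := hl.1 z hz'
      simp only [List.mem_cons, ih hl.2 hz']
      constructor
      · tauto
      · rintro ⟨rfl | h1, h2⟩
        · rcases h2 with h2 | h2
          · exact absurd h2 h
          · exact absurd hxz (hr _ _ h2)
        · exact ⟨h1, h2⟩

theorem mem_uptoT {z : Fin m} {l : List (Fin m)} (hr : ∀ a b, r a b → ¬ r b a)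
    (hl : l.Pairwise r) (hz : z ∈ l) {c : Fin m} :
    c ∈ (uptoT z l).val ↔ c ∈ l ∧ (c = z ∨ r c z) := by
  induction l with
  | nil => simp at hz
  | cons x l ih =>
    rw [List.pairwise_cons] at hl
    simp only [uptoT, Timed.val_bind]
    split_ifs with h
    · subst h
      simp only [Timed.val_pure, List.mem_cons, List.not_mem_nil, or_false]
      constructor
      · rintro rfl; exact ⟨Or.inl rfl, Or.inl rfl⟩
      · rintro ⟨h1 | h1, h2 | h2⟩
        · exact h1
        · exact h1
        · exact h2
        · exact absurd h2 (hr _ _ (hl.1 c h1))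
    · have hz' : z ∈ l := by simpa [Ne.symm h] using hz
      have hxz := hl.1 z hz'
      simp only [Timed.val_pure, Timed.val_bind, List.mem_cons, ih hl.2 hz']
      constructor
      · rintro (rfl | h)
        · exact ⟨Or.inl rfl, Or.inr hxz⟩
        · exact ⟨Or.inr h.1, h.2⟩
      · tauto

end intervals

theorem aboveT_sublist {m : ℕ} (z : Fin m) (l : List (Fin m)) : (aboveT z l).val.Sublist l := by
  induction l with
  | nil => simp [aboveT]
  | cons x l ih =>
    simp only [aboveT, Timed.val_bind]
    split_ifs
    · simp
    · exact ih.cons_cons x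

theorem fromT_sublist {m : ℕ} (z : Fin m) (l : List (Fin m)) : (fromT z l).val.Sublist l := by
  induction l with
  | nil => simp [fromT]
  | cons x l ih =>
    simp only [fromT, Timed.val_bind]
    split_ifs
    · exact List.Sublist.refl _
    · exact ih.cons x

theorem uptoT_sublist {m : ℕ} (z : Fin m) (l : List (Fin m)) : (uptoT z l).val.Sublist l := by
  induction l with
  | nil => simp [uptoT]
  | cons x l ih =>
    simp only [uptoT, Timed.val_bind]
    split_ifs
    · simp
    · exact ih.cons_cons x

theorem filterT_val {m : ℕ} (f : Fin m → Timed Bool) (l : List (Fin m)) :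
    (filterT f l).val = l.filter fun x => (f x).val := by
  induction l with
  | nil => simp [filterT]
  | cons x l ih => simp [filterT, ih, List.filter_cons]

theorem appendT_val {m : ℕ} (l' l : List (Fin m)) : (appendT l' l).val = l ++ l' := by
  induction l with
  | nil => simp [appendT]
  | cons x l ih => simp [appendT, ih]

theorem countBeforeT_val {m : ℕ} (P : Pref m) (x : Fin m) {l : List (Fin m)} (hl : l.Nodup) :
    (countBeforeT P.order x l).val = (l.toFinset.filter fun y => P.prefers y x).card := by
  induction l with
  | nil => simp [countBeforeT]
  | cons y l ih =>
    rw [List.nodup_cons] at hl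
    simp only [countBeforeT, Timed.val_bind, beforeT_val, ih hl.2, Timed.val_pure,
      List.toFinset_cons, Finset.filter_insert]
    by_cases h : P.prefers y x
    · simp [h, hl.1]
    · simp [h]

/-- The head `x` of a list sorted by `P'` contributes the inversions `(y, x)` with `y` later in the
list and above `x` in `P`. -/
theorem swapDistT_val_of_pairwise {m : ℕ} (P P' : Pref m) {l : List (Fin m)}
    (hl : l.Pairwise P'.prefers) :
    (swapDistT P.order l).val = ((l.toFinset ×ˢ l.toFinset).filter
      fun p : Fin m × Fin m => P.prefers p.1 p.2 ∧ P'.prefers p.2 p.1).card := by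
  induction l with
  | nil => simp [swapDistT]
  | cons x l ih =>
    have hnd : (x :: l).Nodup := hl.imp fun {a b} h => h.ne
    rw [List.pairwise_cons] at hl
    rw [List.nodup_cons] at hnd
    simp only [swapDistT, Timed.val_bind, Timed.val_pure, countBeforeT_val P x hnd.2, ih hl.2]
    have hinj : Function.Injective fun y : Fin m => (y, x) := fun a b h => by simpa using h
    rw [← Finset.card_image_of_injective _ hinj, ← Finset.card_union_of_disjoint]
    · congr 1
      ext ⟨a, b⟩
      simp only [Finset.mem_union, Finset.mem_image, Finset.mem_filter, List.mem_toFinset,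
        Prod.mk.injEq, Finset.mem_product, List.toFinset_cons, Finset.mem_insert]
      constructor
      · rintro (⟨y, ⟨h1, h2⟩, rfl, rfl⟩ | h)
        · exact ⟨⟨Or.inr h1, Or.inl rfl⟩, h2, hl.1 _ h1⟩
        · tauto
      · rintro ⟨⟨ha | ha, hb | hb⟩, h1, h2⟩
        · exact absurd (ha.trans hb.symm) h1.ne
        · subst ha; exact absurd (hl.1 b hb) h2.asymm
        · subst hb; exact Or.inl ⟨a, ⟨ha, h1⟩, rfl, rfl⟩
        · exact Or.inr ⟨⟨ha, hb⟩, h1, h2⟩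
    · rw [Finset.disjoint_left]
      rintro ⟨a, b⟩ h1 h2
      simp only [Finset.mem_image, Finset.mem_filter, List.mem_toFinset, Prod.mk.injEq,
        Finset.mem_product] at h1 h2
      obtain ⟨y, _, _, rfl⟩ := h1
      exact hnd.1 h2.1.2

theorem swapDistT_val {m : ℕ} (P P' : Pref m) :
    (swapDistT P.order P'.order).val = swapDist P P' := by
  rw [swapDistT_val_of_pairwise P P' P'.pairwise_order, swapDist]
  congr 1
  ext ⟨a, b⟩
  simp [P'.complete]

/-- Each half of the list is sorted by `P`: `ck` can close the upper half because the pivot is not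
below it and `Y_bad` is forced above it, and `cj` can open the lower half because the pivot is not
above it and `X_bad` is forced below it. -/
theorem buildT_val {m : ℕ} {P : Pref m} {Q : Responses m} {q : List (Fin m × Fin m)}
    {cj ck z : Fin m} (hP : Models P Q) (hq : ∀ p, p ∈ q ↔ p ∈ CL Q) (hjk : P.prefers cj ck)
    (hcl : (cj, ck) ∉ CL Q) (hz : z = cj ∨ P.prefers cj z) (hz' : z = ck ∨ P.prefers z ck) :
    (buildT P.order q cj ck z).val = (block P (pivotSet P Q cj ck z)).order := by
  classical
  set S := pivotSet P Q cj ck z with hS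
  have has : ∀ a b, P.prefers a b → ¬ P.prefers b a := fun a b h => h.asymm
  set X := (aboveT z P.order).val with hX
  set Y := (fromT z P.order).val with hY
  have hXmem : ∀ c, c ∈ X ↔ P.prefers c z := fun c => by
    rw [hX, mem_aboveT has P.pairwise_order (P.complete z)]; simp [P.complete c]
  have hYmem : ∀ c, c ∈ Y ↔ ¬ P.prefers c z := fun c => by
    rw [hY, mem_fromT has P.pairwise_order (P.complete z), P.not_prefers_iff]
    simp [P.complete c]
  have hXp : X.Pairwise P.prefers := P.pairwise_order.sublist (aboveT_sublist _ _)
  have hYp : Y.Pairwise P.prefers := P.pairwise_order.sublist (fromT_sublist _ _)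
  have hXY : ∀ x ∈ X, ∀ y ∈ Y, P.prefers x y := by
    intro x hx y hy
    rw [hXmem] at hx
    rw [hYmem, P.not_prefers_iff] at hy
    rcases hy with rfl | hy
    · exact hx
    · exact hx.trans hy
  have hkz : ¬ P.prefers ck z := by
    rcases hz' with rfl | h
    · exact P.prefers_irrefl _
    · exact h.asymm
  have hcj : ∀ c, ¬ P.prefers c z → c = cj ∨ P.prefers cj c := by
    intro c hc
    rcases P.not_prefers_iff.1 hc with rfl | h <;> rcases hz with rfl | h'
    · exact Or.inl rfl
    · exact Or.inr h'
    · exact Or.inr h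
    · exact Or.inr (h'.trans h)
  have hval : (buildT P.order q cj ck z).val =
      (X.filter (fun x => !decide ((cj, x) ∈ CL Q) && decide (x ≠ cj)) ++
        (Y.filter (fun y => decide ((y, ck) ∈ CL Q)) ++ [ck])) ++
      (cj :: (X.filter (fun x => decide ((cj, x) ∈ CL Q)) ++
        Y.filter (fun y => !decide ((y, ck) ∈ CL Q) && decide (y ≠ ck) && decide (y ≠ cj)))) := by
    simp only [buildT, Timed.val_bind, appendT_val, filterT_val, memT_val, Timed.val_pure, hq,
      List.append_assoc, List.singleton_append, ← hX, ← hY]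
  have hS' : ∀ c, c ∈ S ↔ (P.prefers c z ∧ (cj, c) ∉ CL Q ∧ c ≠ cj) ∨
    (¬ P.prefers c z ∧ ((c, ck) ∈ CL Q ∨ c = ck)) := fun c => Iff.rfl
  rw [hval]
  refine (block P S).order_eq_of_pairwise (r := (block P S).prefers) (fun a b h => h.asymm)
    (block P S).pairwise_order ?_ ?_
  · rw [List.pairwise_append]
    have hA : ∀ a ∈ X.filter (fun x => !decide ((cj, x) ∈ CL Q) && decide (x ≠ cj)) ++
        (Y.filter (fun y => decide ((y, ck) ∈ CL Q)) ++ [ck]), a ∈ S := by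
      intro a ha
      rw [hS']
      simp only [List.mem_append, List.mem_filter, List.mem_singleton, hXmem, hYmem,
        Bool.and_eq_true, Bool.not_eq_true', decide_eq_false_iff_not, decide_eq_true_eq] at ha
      rcases ha with ha | ha | rfl
      · tauto
      · tauto
      · tauto
    have hB : ∀ a ∈ cj :: (X.filter (fun x => decide ((cj, x) ∈ CL Q)) ++
        Y.filter (fun y => !decide ((y, ck) ∈ CL Q) && decide (y ≠ ck) && decide (y ≠ cj))),
        a ∉ S := by
      intro a ha
      rw [hS']
      simp only [List.mem_append, List.mem_filter, List.mem_cons, hXmem, hYmem,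
        Bool.and_eq_true, Bool.not_eq_true', decide_eq_false_iff_not, decide_eq_true_eq] at ha
      rcases ha with rfl | ha | ha
      · have := hjk.ne; tauto
      · tauto
      · tauto
    refine ⟨?_, ?_, fun a ha b hb => block_prefers.2 (Or.inl ⟨hA a ha, hB b hb⟩)⟩
    · refine List.Pairwise.imp_of_mem (R := P.prefers) (fun {a b} ha hb h => block_prefers.2
        (Or.inr ⟨iff_of_true (hA a ha) (hA b hb), h⟩)) ?_
      rw [List.pairwise_append, List.pairwise_append]
      refine ⟨hXp.filter _, ⟨hYp.filter _, List.pairwise_singleton _ _, ?_⟩, ?_⟩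
      · intro a ha b hb
        obtain rfl : b = ck := by simpa using hb
        simp only [List.mem_filter, decide_eq_true_eq] at ha
        exact hP _ _ ha.2
      · intro a ha b hb
        refine hXY a (List.mem_filter.1 ha).1 b ?_
        rcases List.mem_append.1 hb with hb | hb
        · exact (List.mem_filter.1 hb).1
        · obtain rfl : b = ck := by simpa using hb
          exact (hYmem _).2 hkz
    · refine List.Pairwise.imp_of_mem (R := P.prefers) (fun {a b} ha hb h => block_prefers.2
        (Or.inr ⟨iff_of_false (hB a ha) (hB b hb), h⟩)) ?_
      rw [List.pairwise_cons, List.pairwise_append]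
      refine ⟨?_, hXp.filter _, hYp.filter _, fun a ha b hb =>
        hXY a (List.mem_filter.1 ha).1 b (List.mem_filter.1 hb).1⟩
      intro a ha
      simp only [List.mem_append, List.mem_filter, hXmem, hYmem,
        Bool.and_eq_true, Bool.not_eq_true', decide_eq_false_iff_not, decide_eq_true_eq] at ha
      rcases ha with ha | ha
      · exact hP _ _ ha.2
      · exact (hcj a ha.1).resolve_left ha.2.2
  · intro c
    simp only [List.mem_append, List.mem_filter, List.mem_cons, hXmem, hYmem, List.not_mem_nil,
      Bool.and_eq_true, Bool.not_eq_true', decide_eq_false_iff_not, decide_eq_true_eq]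
    tauto

/-! ## Ballots with a prescribed top -/

/-- The ballot that starts with `l`; the other candidates come by increasing `g`, ties being
broken by `N`. -/
def topBallot {m : ℕ} (l : List (Fin m)) (g : Fin m → ℕ) (N : Pref m) : Pref m :=
  -- Meant for `g` vanishing on `l`. Off the list `idxOf` is constantly the length, so only `g` and
  -- `N` matter there.
  lev (fun c => l.idxOf c + g c) N

theorem topBallot_loss {m : ℕ} {l : List (Fin m)} {g : Fin m → ℕ} {N : Pref m}
    (hl : l.Nodup) (hg : ∀ c ∈ l, g c = 0) {c : Fin m} (hc : c ∈ l) :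
    loss (topBallot l g N) c = l.idxOf c := by
  have hlen := List.idxOf_lt_length_of_mem hc
  have hcard : ((l.take (l.idxOf c)).toFinset).card = l.idxOf c := by
    rw [List.toFinset_card_of_nodup (hl.sublist (List.take_sublist _ _)), List.length_take]
    omega
  have hmem : ∀ d, d ∈ (l.take (l.idxOf c)).toFinset ↔ l.idxOf d < l.idxOf c := by
    intro d
    rw [List.mem_toFinset]
    constructor
    · intro h
      exact (List.mem_take_iff_idxOf_lt (List.mem_of_mem_take h)).1 h
    · intro h
      exact (List.mem_take_iff_idxOf_lt (List.idxOf_lt_length_iff.1 (h.trans hlen))).2 h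
  apply le_antisymm
  · conv_rhs => rw [← hcard]
    refine loss_le _ fun d hd => (hmem d).2 ?_
    rcases lev_prefers.1 hd with h | ⟨h, h'⟩
    · simp only [hg c hc] at h; omega
    · simp only [hg c hc] at h
      by_contra hn
      have h1 : l.idxOf d = l.idxOf c := by omega
      have : d = c := by
        have hd : d ∈ l := List.idxOf_lt_length_iff.1 (h1 ▸ hlen)
        exact (List.idxOf_inj hd).1 h1
      exact h'.ne this
  · conv_lhs => rw [← hcard]
    refine le_loss _ fun d hd => lev_of_lt ?_
    have h1 := (hmem d).1 hd
    have h2 : d ∈ l := List.idxOf_lt_length_iff.1 (h1.trans hlen)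
    simp only [hg c hc, hg d h2]
    exact h1

theorem length_le_topBallot_loss {m : ℕ} {l : List (Fin m)} {g : Fin m → ℕ} {N : Pref m}
    (hl : l.Nodup) (hg : ∀ c ∈ l, g c = 0) {c : Fin m} (hc : c ∉ l) :
    l.length ≤ loss (topBallot l g N) c := by
  rw [← List.toFinset_card_of_nodup hl]
  refine le_loss _ fun d hd => lev_of_lt ?_
  rw [List.mem_toFinset] at hd
  have := List.idxOf_lt_length_of_mem hd
  have := List.idxOf_eq_length_iff.2 hc
  simp only [hg d hd]
  omega

/-! ## Responses of the other voters -/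

/-- The responses of a voter who ranks `W` above the rest, the rest being ordered by `N`; only
`z` need not be above the members of `SA`. -/
def bottomResponses {m : ℕ} (W : Finset (Fin m)) (z : Fin m) (N : Pref m) (SA : Finset (Fin m)) :
    Responses m :=
  {p | (p.1 ∈ W ∧ p.2 ∉ W ∧ ¬ (p.1 = z ∧ p.2 ∈ SA)) ∨ (p.1 ∉ W ∧ p.2 ∉ W ∧ N.prefers p.1 p.2)}

/-- The responses of a voter who ranks `W` above the rest, the rest being ordered by the reverse of
`N`, and who ranks `z` above all candidates outside `SC`. -/
def topResponses {m : ℕ} (W : Finset (Fin m)) (z : Fin m) (N : Pref m) (SC : Finset (Fin m)) :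
    Responses m :=
  {p | (p.1 ∈ W ∧ p.2 ∉ W) ∨ (p.1 = z ∧ p.2 ∈ W ∧ p.2 ≠ z ∧ p.2 ∉ SC) ∨
    (p.1 ∉ W ∧ p.2 ∉ W ∧ N.prefers p.2 p.1)}

/-- The responses of a voter who ranks `W` above the rest. -/
def blockResponses {m : ℕ} (W : Finset (Fin m)) : Responses m := {p | p.1 ∈ W ∧ p.2 ∉ W}

/-- The part of `F` down to `z`, reversed, followed by the other candidates. -/
def turned {m : ℕ} (F : Pref m) (z : Fin m) : Pref m :=
  lev (fun c => if F.prefers z c then 1 else 0) F.rev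

/-- The responses of a voter whose ballot is `P`. -/
def fullResponses {m : ℕ} (P : Pref m) : Responses m := {p | P.prefers p.1 p.2}

theorem models_fullResponses {m : ℕ} (P : Pref m) : Models P (fullResponses P) :=
  models_iff.2 fun _ _ h => h

theorem turned_prefers {m : ℕ} {F : Pref m} {z a b : Fin m} (hb : ¬ F.prefers z a)
    (h : F.prefers b a) : (turned F z).prefers a b := by
  have hzb : ¬ F.prefers z b := fun h' => hb (h'.trans h)
  exact lev_of_eq (by simp [hb, hzb]) (rev_prefers.2 h)

theorem turned_top {m : ℕ} {F : Pref m} {z c : Fin m} (hc : c ≠ z) :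
    (turned F z).prefers z c := by
  rcases F.prefers_or hc with h | h
  · exact turned_prefers (F.prefers_irrefl z) h
  · exact lev_of_lt (by simp [h, F.prefers_irrefl z])

/-- Above `w` in the turned order stand exactly the candidates below `w` in `F` that are not below
`z`. Hence the two ballots together do not distinguish the candidates down to `z`, and a voter with
this ballot cancels `F` on them. -/
theorem loss_add_loss_turned {m : ℕ} {F : Pref m} {z w : Fin m} (hw : w = z ∨ F.prefers w z) :
    loss F w + loss (turned F z) w = loss F z := by
  have hwz : loss F w ≤ loss F z := by
    rcases hw with rfl | h
    · exact le_rfl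
    · exact le_of_lt h
  have hzw : ¬ F.prefers z w := not_lt.2 hwz
  have h := card_filter_loss F (fun k => loss F w < k ∧ k ≤ loss F z)
  have h2 : (Finset.range m).filter (fun k => loss F w < k ∧ k ≤ loss F z) =
      Finset.Ioc (loss F w) (loss F z) := by
    ext k
    have : loss F z < m := F.idxOf_lt z
    simp only [Finset.mem_filter, Finset.mem_range, Finset.mem_Ioc]
    omega
  rw [h2, Nat.card_Ioc] at h
  have h3 : loss (turned F z) w =
      (Finset.univ.filter fun d => loss F w < loss F d ∧ loss F d ≤ loss F z).card := by
    rw [loss_eq_card]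
    congr 1
    ext d
    rw [mem_above]
    simp only [Finset.mem_filter, Finset.mem_univ, true_and]
    constructor
    · intro hd
      rw [turned, lev_prefers, rev_prefers] at hd
      by_cases hzd : F.prefers z d
      · simp [hzd, hzw] at hd
      · simp only [hzd, hzw, if_false, lt_irrefl, true_and, false_or] at hd
        exact ⟨hd, not_lt.1 hzd⟩
    · rintro ⟨h1, h2⟩
      exact turned_prefers (not_lt.2 h2) h1
  omega

theorem topBallot_bottomResponses {m : ℕ} {W : Finset (Fin m)} {z : Fin m} {N : Pref m}
    {SA : Finset (Fin m)} {l : List (Fin m)} {g : Fin m → ℕ} (hl : ∀ c ∈ l, c ∈ W)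
    (hg : ∀ a b, a ∈ W → b ∉ W → ¬ (a = z ∧ b ∈ SA) → g a < g b)
    (hN : ∀ a b, a ∉ W → b ∉ W → N.prefers a b → g a ≤ g b) :
    Models (topBallot l g N) (bottomResponses W z N SA) := by
  have hlen : ∀ b, b ∉ W → l.idxOf b = l.length := fun b hb =>
    List.idxOf_eq_length_iff.2 fun h => hb (hl b h)
  rw [models_iff]
  rintro a b (⟨h1, h2, h3⟩ | ⟨h1, h2, h3⟩)
  · refine lev_of_lt ?_
    have := hg a b h1 h2 h3
    have h4 : l.idxOf a ≤ l.length := List.idxOf_le_length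
    have := hlen b h2
    omega
  · have h4 := hlen a h1
    have h5 := hlen b h2
    rcases (hN a b h1 h2 h3).lt_or_eq with h | h
    · exact lev_of_lt (by omega)
    · exact lev_of_eq (by omega) h3

theorem topBallot_topResponses {m : ℕ} {W : Finset (Fin m)} {z : Fin m} {N : Pref m}
    {SC : Finset (Fin m)} {l : List (Fin m)} {g : Fin m → ℕ} (hl : ∀ c ∈ l, c ∈ W)
    (hg : ∀ a b, a ∈ W → b ∉ W → g a < g b)
    (hN : ∀ a b, a ∉ W → b ∉ W → g a = g b) (hgz : g z = 0)
    (hz : ∀ b ∈ W, b ≠ z → b ∉ SC → l.idxOf z < l.idxOf b) :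
    Models (topBallot l g N.rev) (topResponses W z N SC) := by
  have hlen : ∀ b, b ∉ W → l.idxOf b = l.length := fun b hb =>
    List.idxOf_eq_length_iff.2 fun h => hb (hl b h)
  rw [models_iff]
  rintro a b (⟨h1, h2⟩ | ⟨h0, h1, h2, h3⟩ | ⟨h1, h2, h3⟩)
  · refine lev_of_lt ?_
    have := hg a b h1 h2
    have h4 : l.idxOf a ≤ l.length := List.idxOf_le_length
    have := hlen b h2
    omega
  · simp only at h0
    subst h0
    have := hz b h1 h2 h3
    exact lev_of_lt (by omega)
  · have h4 := hlen a h1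
    have h5 := hlen b h2
    have h6 := hN a b h1 h2
    exact lev_of_eq (by omega) (rev_prefers.2 h3)

theorem topBallot_blockResponses {m : ℕ} {W : Finset (Fin m)} {N : Pref m}
    {l : List (Fin m)} {g : Fin m → ℕ} (hl : ∀ c ∈ l, c ∈ W)
    (hg : ∀ a b, a ∈ W → b ∉ W → g a < g b) :
    Models (topBallot l g N) (blockResponses W) := by
  rw [models_iff]
  rintro a b ⟨h1, h2⟩
  refine lev_of_lt ?_
  have := hg a b h1 h2
  have h4 : l.idxOf a ≤ l.length := List.idxOf_le_length
  have : l.idxOf b = l.length := List.idxOf_eq_length_iff.2 fun h => h2 (hl b h)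
  omega

theorem loss_blockResponses {m : ℕ} {W : Finset (Fin m)} {E : Pref m}
    (hE : Models E (blockResponses W)) {z u : Fin m} (hz : z ∈ W) (hu : u ∉ W) :
    loss E z ≤ loss E u := by
  have h : E.prefers z u := models_iff.1 hE z u ⟨hz, hu⟩
  exact le_of_lt h

/-- `z` has a smaller loss than the candidates outside `W`. -/
theorem loss_lt_of_notMem {m : ℕ} {W : Finset (Fin m)} {F N A B C D : Pref m} {z u : Fin m}
    {SA SC : Finset (Fin m)} (hz : z ∈ W) (hu : u ∉ W) (hS : SA.card + SC.card ≤ 1)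
    (hSA : ∀ u ∈ SA, ∃ c, F.prefers u c ∧ F.prefers c z)
    (hA : Models A (bottomResponses W z N SA)) (hB : Models B (fullResponses (turned F z)))
    (hC : Models C (topResponses W z N SC)) :
    loss D z + (loss A z + (loss B z + loss C z)) <
      loss D u + (loss A u + (loss B u + loss C u)) := by
  rw [models_iff] at hA hB hC
  have huz : u ≠ z := by rintro rfl; exact hu hz
  have hcW : W.card = (W.erase z).card + 1 := (Finset.card_erase_add_one hz).symm
  -- Upper bounds for `z`: `W.card - 1 + SA.card` in `A`, `0` in `B`, `SC.card` in `C` and `m - 1`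
  -- in `D`, together at most `m + W.card - 1`.
  have a1 : loss A z ≤ (W.erase z).card + SA.card := by
    refine (loss_le (W.erase z ∪ SA) fun d hd => ?_).trans (Finset.card_union_le _ _)
    rw [Finset.mem_union, Finset.mem_erase]
    by_cases h1 : d ∈ W
    · exact Or.inl ⟨hd.ne, h1⟩
    · by_contra hn
      have : d ∉ SA := fun h => hn (Or.inr h)
      exact hd.asymm (hA z d (Or.inl ⟨hz, h1, fun h => this h.2⟩))
  have c1 : loss C z ≤ SC.card := by
    refine loss_le _ fun d hd => ?_
    by_contra hn
    by_cases h1 : d ∈ W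
    · exact hd.asymm (hC z d (Or.inr (Or.inl ⟨rfl, h1, hd.ne, hn⟩)))
    · exact hd.asymm (hC z d (Or.inl ⟨hz, h1⟩))
  have b1 : loss B z ≤ 0 := by
    refine loss_le ∅ fun d hd => ?_
    exact absurd (hB z d (turned_top hd.ne)) hd.asymm
  have d1 : loss D z < m := D.idxOf_lt z
  -- `A` and `C` rank the outsiders by opposite orders, so each outsider other than `u` is above `u`
  -- in one of them. With `W` counted twice this costs `u` at least `m + W.card - 1` when `u` is not
  -- in `SA`, and `B` adds the decisive unit.
  set U1 := Finset.univ.filter (fun v => v ∉ W ∧ N.prefers v u) with hU1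
  set U2 := Finset.univ.filter (fun v => v ∉ W ∧ N.prefers u v) with hU2
  have hU : U1.card + U2.card + 1 + W.card = m := by
    have hd : Disjoint U1 U2 := by
      rw [Finset.disjoint_left]
      intro v h1 h2
      simp only [hU1, hU2, Finset.mem_filter] at h1 h2
      exact h1.2.2.asymm h2.2.2
    have hd2 : u ∉ U1 ∪ U2 := by
      simp [hU1, hU2, N.prefers_irrefl]
    have hd3 : Disjoint (insert u (U1 ∪ U2)) W := by
      rw [Finset.disjoint_left]
      intro v h1 h2
      simp only [hU1, hU2, Finset.mem_insert, Finset.mem_union, Finset.mem_filter] at h1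
      rcases h1 with rfl | h1 | h1
      · exact hu h2
      · exact h1.2.1 h2
      · exact h1.2.1 h2
    have hall : insert u (U1 ∪ U2) ∪ W = Finset.univ := by
      ext v
      simp only [hU1, hU2, Finset.mem_insert, Finset.mem_union, Finset.mem_filter,
        Finset.mem_univ, true_and, iff_true]
      by_cases h1 : v = u
      · tauto
      · have := N.prefers_or h1
        tauto
    have := congrArg Finset.card hall
    rw [Finset.card_union_of_disjoint hd3, Finset.card_insert_of_notMem hd2,
      Finset.card_union_of_disjoint hd, Finset.card_univ, Fintype.card_fin] at this
    exact this
  have c2 : W.card + U2.card ≤ loss C u := by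
    rw [← Finset.card_union_of_disjoint]
    · refine le_loss _ fun d hd => ?_
      rcases Finset.mem_union.1 hd with h | h
      · exact hC d u (Or.inl ⟨h, hu⟩)
      · simp only [hU2, Finset.mem_filter] at h
        exact hC d u (Or.inr (Or.inr ⟨h.2.1, hu, h.2.2⟩))
    · rw [Finset.disjoint_left]
      intro v h1 h2
      simp only [hU2, Finset.mem_filter] at h2
      exact h2.2.1 h1
  -- An exempt `u` may pass `z` in `A`, which saves one unit; the candidate between `u` and `z` in
  -- `F` restores it, being above `u` in the turned order.
  by_cases huS : u ∈ SA
  · have a2 : (W.erase z).card + U1.card ≤ loss A u := by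
      rw [← Finset.card_union_of_disjoint]
      · refine le_loss _ fun d hd => ?_
        rcases Finset.mem_union.1 hd with h | h
        · rw [Finset.mem_erase] at h
          exact hA d u (Or.inl ⟨h.2, hu, fun h' => h.1 h'.1⟩)
        · simp only [hU1, Finset.mem_filter] at h
          exact hA d u (Or.inr ⟨h.2.1, hu, h.2.2⟩)
      · rw [Finset.disjoint_left]
        intro v h1 h2
        simp only [hU1, Finset.mem_filter] at h2
        exact h2.2.1 (Finset.mem_of_mem_erase h1)
    obtain ⟨c, hc1, hc2⟩ := hSA u huS
    have b2 : 2 ≤ loss B u := by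
      rw [← Finset.card_pair hc2.ne]
      refine le_loss _ fun d hd => ?_
      rw [Finset.mem_insert, Finset.mem_singleton] at hd
      rcases hd with rfl | rfl
      · exact hB _ _ (turned_prefers hc2.asymm hc1)
      · exact hB _ _ (turned_top huz)
    omega
  · have a2 : W.card + U1.card ≤ loss A u := by
      rw [← Finset.card_union_of_disjoint]
      · refine le_loss _ fun d hd => ?_
        rcases Finset.mem_union.1 hd with h | h
        · exact hA d u (Or.inl ⟨h, hu, fun h' => huS h'.2⟩)
        · simp only [hU1, Finset.mem_filter] at h
          exact hA d u (Or.inr ⟨h.2.1, hu, h.2.2⟩)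
      · rw [Finset.disjoint_left]
        intro v h1 h2
        simp only [hU1, Finset.mem_filter] at h2
        exact h2.2.1 h1
    have b2 : 1 ≤ loss B u := by
      rw [← Finset.card_singleton z]
      refine le_loss _ fun d hd => ?_
      rw [Finset.mem_singleton] at hd
      subst hd
      exact hB _ _ (turned_top huz)
    omega

/-! ## Profiles with three distinguished voters -/

/-- The family with given entries at `a`, `b`, `c`. -/
def family {n : ℕ} {α : Type*} (a b c : Fin n) (A B C : α) (E : Fin n → α) (v : Fin n) : α :=
  if v = a then A else if v = b then B else if v = c then C else E v

theorem exists_three {n : ℕ} (hn : 4 ≤ n) (i : Fin n) :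
    ∃ (a b c : Fin n) (E : Finset (Fin n)), E.card + 4 = n ∧ i ∉ E ∧ a ∉ E ∧ b ∉ E ∧ c ∉ E ∧
      a ≠ i ∧ b ≠ i ∧ c ≠ i ∧ b ≠ a ∧ c ≠ a ∧ c ≠ b ∧
      (∀ v, v ≠ i → v = a ∨ v = b ∨ v = c ∨ v ∈ E) := by
  have h1 : 2 < (Finset.univ.erase i).card := by
    rw [Finset.card_erase_of_mem (Finset.mem_univ _), Finset.card_univ, Fintype.card_fin]; omega
  obtain ⟨a, b, c, ha, hb, hc, hab, hac, hbc⟩ := Finset.two_lt_card_iff.1 h1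
  have ha' := Finset.ne_of_mem_erase ha
  have hb' := Finset.ne_of_mem_erase hb
  have hc' := Finset.ne_of_mem_erase hc
  refine ⟨a, b, c, ((({i, a, b, c} : Finset (Fin n)))ᶜ), ?_, by simp, by simp, by simp, by simp,
    ha', hb', hc', hab.symm, hac.symm, hbc.symm, ?_⟩
  · have : ({i, a, b, c} : Finset (Fin n)).card = 4 := by
      rw [Finset.card_insert_of_notMem, Finset.card_insert_of_notMem, Finset.card_pair hbc]
      · simp [hab, hac]
      · simp [ha'.symm, hb'.symm, hc'.symm]
    rw [Finset.card_compl, this, Fintype.card_fin]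
    omega
  · intro v hv
    simp only [Finset.mem_compl, Finset.mem_insert, Finset.mem_singleton]
    tauto

/-- The total loss of `c` over a profile with three distinguished voters. -/
theorem totalLoss_family {n m : ℕ} {i a b c : Fin n} {E : Finset (Fin n)} (hi : i ∉ E)
    (ha : a ∉ E) (hb : b ∉ E) (hc : c ∉ E) (hai : a ≠ i) (hbi : b ≠ i) (hci : c ≠ i)
    (hba : b ≠ a) (hca : c ≠ a) (hcb : c ≠ b)
    (hall : ∀ v, v ≠ i → v = a ∨ v = b ∨ v = c ∨ v ∈ E)
    (A B C D : Pref m) (RE : Fin n → Pref m) (d : Fin m) :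
    totalLoss (Function.update (family a b c A B C RE) i D) d =
      loss D d + (loss A d + (loss B d + loss C d)) + ∑ v ∈ E, loss (RE v) d := by
  have hE : Finset.univ.erase i = insert a (insert b (insert c E)) := by
    ext v
    simp only [Finset.mem_erase, Finset.mem_univ, and_true, Finset.mem_insert]
    refine ⟨hall v, ?_⟩
    rintro (rfl | rfl | rfl | h)
    · exact hai
    · exact hbi
    · exact hci
    · rintro rfl; exact hi h
  rw [totalLoss_update, hE, Finset.sum_insert, Finset.sum_insert, Finset.sum_insert hc]
  · have hsum : ∑ v ∈ E, loss (family a b c A B C RE v) d = ∑ v ∈ E, loss (RE v) d := by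
      refine Finset.sum_congr rfl fun v hv => ?_
      have h1 : v ≠ a := by rintro rfl; exact ha hv
      have h2 : v ≠ b := by rintro rfl; exact hb hv
      have h3 : v ≠ c := by rintro rfl; exact hc hv
      simp [family, h1, h2, h3]
    rw [hsum]
    simp only [family, hba, hca, hcb, if_true, if_false]
    ring
  · simp [hcb.symm, hb]
  · simp [hba.symm, hca.symm, ha]

/-- The level function that puts `W` above the rest. -/
def below {m : ℕ} (W : Finset (Fin m)) (c : Fin m) : ℕ := if c ∈ W then 0 else 1

theorem below_of_mem {m : ℕ} {W : Finset (Fin m)} {c : Fin m} (h : c ∈ W) : below W c = 0 := by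
  simp [below, h]

theorem below_of_notMem {m : ℕ} {W : Finset (Fin m)} {c : Fin m} (h : c ∉ W) :
    below W c = 1 := by
  simp [below, h]

theorem below_lt {m : ℕ} {W : Finset (Fin m)} {a b : Fin m} (ha : a ∈ W) (hb : b ∉ W) :
    below W a < below W b := by
  simp [below, ha, hb]

/-- The level function that puts `W` above the rest and `z` last within `W`. -/
def belowLast {m : ℕ} (W : Finset (Fin m)) (z : Fin m) (c : Fin m) : ℕ :=
  if c = z then 1 else if c ∈ W then 0 else 2

theorem two_le_topBallot_pair_loss {m : ℕ} {g : Fin m → ℕ} {N : Pref m} {a b c : Fin m}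
    (hab : a ≠ b) (ha : g a = 0) (hb : g b = 0) (hca : c ≠ a) (hcb : c ≠ b) :
    2 ≤ loss (topBallot [a, b] g N) c :=
  length_le_topBallot_loss (l := [a, b]) (by simp [hab]) (by simp [ha, hb]) (by simp [hca, hcb])

theorem topBallot_pair_loss_fst {m : ℕ} {g : Fin m → ℕ} {N : Pref m} {a b : Fin m}
    (hab : a ≠ b) (ha : g a = 0) (hb : g b = 0) : loss (topBallot [a, b] g N) a = 0 := by
  rw [topBallot_loss (by simp [hab]) (by simp [ha, hb]) (by simp)]
  simp

theorem topBallot_pair_loss_snd {m : ℕ} {g : Fin m → ℕ} {N : Pref m} {a b : Fin m}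
    (hab : a ≠ b) (ha : g a = 0) (hb : g b = 0) : loss (topBallot [a, b] g N) b = 1 := by
  rw [topBallot_loss (by simp [hab]) (by simp [ha, hb]) (by simp)]
  simp [hab]

theorem topBallot_triple_loss {m : ℕ} {g : Fin m → ℕ} {N : Pref m} {a b c : Fin m}
    (hab : a ≠ b) (hac : a ≠ c) (hbc : b ≠ c) (ha : g a = 0) (hb : g b = 0) (hc : g c = 0) :
    loss (topBallot [a, b, c] g N) a = 0 ∧ loss (topBallot [a, b, c] g N) b = 1 ∧
      loss (topBallot [a, b, c] g N) c = 2 ∧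
      ∀ d, d ≠ a → d ≠ b → d ≠ c → 3 ≤ loss (topBallot [a, b, c] g N) d := by
  have hnd : [a, b, c].Nodup := by simp [hab, hac, hbc]
  have hg : ∀ d ∈ [a, b, c], g d = 0 := by simp [ha, hb, hc]
  refine ⟨?_, ?_, ?_, fun d h1 h2 h3 => length_le_topBallot_loss hnd hg (by simp [h1, h2, h3])⟩
  · rw [topBallot_loss hnd hg (by simp)]; simp
  · rw [topBallot_loss hnd hg (by simp)]; simp [hab]
  · rw [topBallot_loss hnd hg (by simp)]; simp [hac, hbc]

/-- A possible world in which `x` wins with `F` and `y` wins with `G`, from suitable ballots `A`,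
`C` of two voters, while a third voter compensates for `F`. -/
theorem exists_world_of_ballots {n m : ℕ} {T : Pref m} {Q : Fin n → Responses m} {i : Fin n}
    (hn : 4 ≤ n) {W : Finset (Fin m)} (hW : ∀ c, c ∈ W ↔ c ∈ possibleWinners T Q) {F G : Pref m}
    (hF : Models F (Q i)) (hG : Models G (Q i)) {x y z : Fin m} (hx : x ∈ W) (hy : y ∈ W)
    (hxy : x ≠ y) (hz : z ∈ W) (hlast : ∀ w ∈ W, w = z ∨ F.prefers w z)
    (he : ∀ w ∈ W, loss F w + loss G y ≤ loss G w + loss F y)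
    (hex : loss F x + loss G y < loss G x + loss F y)
    (N : Pref m) (SA SC : Finset (Fin m)) (hS : SA.card + SC.card ≤ 1)
    (hSA : ∀ u ∈ SA, ∃ c, F.prefers u c ∧ F.prefers c z) {A C : Pref m}
    (hA : Models A (bottomResponses W z N SA)) (hC : Models C (topResponses W z N SC))
    {d : ℕ} (hd : d ≤ 1) (hdxy : loss A x + loss C x + d = loss A y + loss C y)
    (hdw : ∀ w ∈ W, w ≠ x → w ≠ y → loss A y + loss C y < loss A w + loss C w)
    (hpar : (T.prefers x y ∧ Even (n + d)) ∨ (T.prefers y x ∧ Odd (n + d))) :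
    ∃ R, IsPossibleWorld T Q i R ∧ IsWinner T (Function.update R i F) x ∧
      IsWinner T (Function.update R i G) y := by
  obtain ⟨a, b, c, E, hEn, hi, ha, hb, hc, hai, hbi, hci, hba, hca, hcb, hall⟩ := exists_three hn i
  have htot := totalLoss_family (m := m) hi ha hb hc hai hbi hci hba hca hcb hall
  set Q' : Fin n → Responses m := fun v => if v = i then Q i else
    family a b c (bottomResponses W z N SA) (fullResponses (turned F z)) (topResponses W z N SC)
      (fun _ => blockResponses W) v with hQ'
  have hQ'i : Q' i = Q i := by simp [hQ']
  have hmodels : ∀ {A B C : Pref m} {RE : Fin n → Pref m}, Models A (bottomResponses W z N SA) →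
      Models B (fullResponses (turned F z)) → Models C (topResponses W z N SC) →
      (∀ v, Models (RE v) (blockResponses W)) → ∀ v, v ≠ i →
      Models (family a b c A B C RE v) (Q' v) := by
    intro A B C RE hA hB hC hE v hv
    simp only [hQ', if_neg hv]
    unfold family
    split_ifs
    · exact hA
    · exact hB
    · exact hC
    · exact hE v
  have hBm := models_fullResponses (turned F z)
  -- Whatever voter `i` does, `z` beats every outsider. So only members of `W` win, and winning
  -- requires only beating the rest of `W`.
  have hout : ∀ {A B C D : Pref m} {RE : Fin n → Pref m}, Models A (bottomResponses W z N SA) →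
      Models B (fullResponses (turned F z)) → Models C (topResponses W z N SC) →
      (∀ v ∈ E, Models (RE v) (blockResponses W)) → ∀ u, u ∉ W →
      totalLoss (Function.update (family a b c A B C RE) i D) z <
        totalLoss (Function.update (family a b c A B C RE) i D) u := by
    intro A B C D RE hA hB hC hE u hu
    rw [htot, htot]
    have h1 := loss_lt_of_notMem (D := D) hz hu hS hSA hA hB hC
    have h2 : ∑ v ∈ E, loss (RE v) z ≤ ∑ v ∈ E, loss (RE v) u :=
      Finset.sum_le_sum fun v hv => loss_blockResponses (hE v hv) hz hu
    omega
  have hwin : ∀ {A B C D : Pref m} {RE : Fin n → Pref m}, Models A (bottomResponses W z N SA) →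
      Models B (fullResponses (turned F z)) → Models C (topResponses W z N SC) →
      (∀ v, Models (RE v) (blockResponses W)) → ∀ w ∈ W,
      (∀ w' ∈ W, w' ≠ w → totalLoss (Function.update (family a b c A B C RE) i D) w <
        totalLoss (Function.update (family a b c A B C RE) i D) w' ∨
        (totalLoss (Function.update (family a b c A B C RE) i D) w =
        totalLoss (Function.update (family a b c A B C RE) i D) w' ∧ T.prefers w w')) →
      IsWinner T (Function.update (family a b c A B C RE) i D) w := by
    intro A B C D RE hA hB hC hE w hw h
    rw [isWinner_iff]
    intro w' hw'
    by_cases hW' : w' ∈ W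
    · exact h w' hW' hw'
    · have h1 := hout (D := D) hA hB hC (fun v _ => hE v) w' hW'
      by_cases hwz : w = z
      · subst hwz; exact Or.inl h1
      · have := h z hz (Ne.symm hwz)
        exact Or.inl (by omega)
  -- the world in which `x` and `y` are close
  obtain ⟨e1, hE1, hE2⟩ : ∃ e1, e1 ≤ E.card ∧
      ((T.prefers x y ∧ d + e1 + e1 = E.card) ∨ (T.prefers y x ∧ d + e1 + e1 = E.card + 1)) := by
    rcases hpar with ⟨h, k, hk⟩ | ⟨h, k, hk⟩
    · exact ⟨(E.card - d) / 2, by omega, Or.inl ⟨h, by omega⟩⟩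
    · exact ⟨(E.card + 1 - d) / 2, by omega, Or.inr ⟨h, by omega⟩⟩
  -- `E1` ranks `x` first and the rest of `E` ranks `y` first. With `F` cancelled, the choice of
  -- `e1` makes `x` and `y` tie if `T` favours `x`, and puts `x` one point ahead if `T` favours `y`.
  obtain ⟨E1, hE1sub, hE1card⟩ := Finset.exists_subset_card_eq hE1
  set RE : Fin n → Pref m := fun v =>
    if v ∈ E1 then topBallot [x, y] (below W) T else topBallot [y, x] (below W) T with hRE
  have hREm : ∀ v, Models (RE v) (blockResponses W) := by
    intro v
    simp only [hRE]
    split_ifs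
    · exact topBallot_blockResponses (by simp [hx, hy]) fun _ _ => below_lt
    · exact topBallot_blockResponses (by simp [hx, hy]) fun _ _ => below_lt
  have hbx := below_of_mem hx
  have hby := below_of_mem hy
  have hsplit : ∀ f : Fin n → ℕ, ∑ v ∈ E, f v = ∑ v ∈ E \ E1, f v + ∑ v ∈ E1, f v := fun f =>
    (Finset.sum_sdiff hE1sub).symm
  have hE2card : (E \ E1).card = E.card - e1 := by
    rw [Finset.card_sdiff_of_subset hE1sub, hE1card]
  have hsumx : ∑ v ∈ E, loss (RE v) x = E.card - e1 := by
    rw [hsplit, Finset.sum_congr rfl (g := fun _ => 1), Finset.sum_congr (s₁ := E1) rfl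
      (g := fun _ => 0)]
    · simp [hE2card]
    · intro v hv
      simp only [hRE, if_pos hv]
      exact topBallot_pair_loss_fst hxy hbx hby
    · intro v hv
      simp only [hRE, if_neg (Finset.mem_sdiff.1 hv).2]
      exact topBallot_pair_loss_snd hxy.symm hby hbx
  have hsumy : ∑ v ∈ E, loss (RE v) y = e1 := by
    rw [hsplit, Finset.sum_congr rfl (g := fun _ => 0), Finset.sum_congr (s₁ := E1) rfl
      (g := fun _ => 1)]
    · simp [hE1card]
    · intro v hv
      simp only [hRE, if_pos hv]
      exact topBallot_pair_loss_snd hxy hbx hby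
    · intro v hv
      simp only [hRE, if_neg (Finset.mem_sdiff.1 hv).2]
      exact topBallot_pair_loss_fst hxy.symm hby hbx
  have hsumw : ∀ w, w ≠ x → w ≠ y → E.card * 2 ≤ ∑ v ∈ E, loss (RE v) w := by
    intro w h1 h2
    rw [← smul_eq_mul]
    refine Finset.card_nsmul_le_sum _ _ _ fun v _ => ?_
    simp only [hRE]
    split_ifs
    · exact two_le_topBallot_pair_loss hxy hbx hby h1 h2
    · exact two_le_topBallot_pair_loss hxy.symm hby hbx h2 h1
  have hflat : ∀ w ∈ W, loss F w + loss (turned F z) w = loss F z := fun w hw =>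
    loss_add_loss_turned (hlast w hw)
  set R := family a b c A (turned F z) C RE with hR
  have hfx := hflat x hx
  have hfy := hflat y hy
  have hwinF : IsWinner T (Function.update R i F) x := by
    refine hwin hA hBm hC hREm x hx fun w hw hwx => ?_
    rw [htot, htot, hsumx]
    have hfw := hflat w hw
    by_cases hwy : w = y
    · subst hwy
      rw [hsumy]
      rcases hE2 with ⟨h1, h2⟩ | ⟨h1, h2⟩
      · exact Or.inr ⟨by omega, h1⟩
      · exact Or.inl (by omega)
    · have h1 := hsumw w hwx hwy
      have h2 := hdw w hw hwx hwy
      exact Or.inl (by omega)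
  -- From `F` to `G` candidate `y` improves on `x` by at least one, which breaks the tie or levels a
  -- lead of one that `T` then decides for `y`.
  have hwinG : IsWinner T (Function.update R i G) y := by
    refine hwin hA hBm hC hREm y hy fun w hw hwy => ?_
    rw [htot, htot, hsumy]
    have hfw := hflat w hw
    have hew := he w hw
    by_cases hwx : w = x
    · subst hwx
      rw [hsumx]
      rcases hE2 with ⟨h1, h2⟩ | ⟨h1, h2⟩
      · exact Or.inl (by omega)
      · by_cases heq : loss G y + (loss A y + (loss (turned F z) y + loss C y)) + e1 <
          loss G w + (loss A w + (loss (turned F z) w + loss C w)) + (E.card - e1)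
        · exact Or.inl heq
        · exact Or.inr ⟨by omega, h1⟩
    · have h1 := hsumw w hwx hwy
      have h2 := hdw w hw hwx hwy
      exact Or.inl (by omega)
  have hupd : ∀ {A B C D : Pref m} {RE : Fin n → Pref m}, Models D (Q i) →
      Models A (bottomResponses W z N SA) →
      Models B (fullResponses (turned F z)) → Models C (topResponses W z N SC) →
      (∀ v, Models (RE v) (blockResponses W)) →
      ∀ v, Models (Function.update (family a b c A B C RE) i D v) (Q' v) := by
    intro A B C D RE hD hA hB hC hE v
    by_cases hv : v = i
    · subst hv; rw [Function.update_self, hQ'i]; exact hD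
    · rw [Function.update_of_ne hv]; exact hmodels hA hB hC hE v hv
  refine ⟨R, ⟨Q', hQ'i, hmodels hA hBm hC hREm, ?_⟩, hwinF, hwinG⟩
  ext w
  rw [← hW]
  constructor
  · rintro ⟨R', hR', hw⟩
    by_contra hwW
    have hiR := hR' i
    have hRa : Models (R' a) (bottomResponses W z N SA) := by
      have := hR' a; simpa [hQ', family, hai] using this
    have hRb : Models (R' b) (fullResponses (turned F z)) := by
      have := hR' b; simpa [hQ', family, hbi, hba] using this
    have hRc : Models (R' c) (topResponses W z N SC) := by
      have := hR' c; simpa [hQ', family, hci, hca, hcb] using this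
    have hRE : ∀ v ∈ E, Models (R' v) (blockResponses W) := by
      intro v hv
      have h0 : v ≠ i := by rintro rfl; exact hi hv
      have h1 : v ≠ a := by rintro rfl; exact ha hv
      have h2 : v ≠ b := by rintro rfl; exact hb hv
      have h3 : v ≠ c := by rintro rfl; exact hc hv
      have := hR' v
      simpa [hQ', family, h0, h1, h2, h3] using this
    have heq : Function.update (family a b c (R' a) (R' b) (R' c) R') i (R' i) = R' := by
      funext v
      by_cases hv : v = i
      · subst hv; simp
      · rw [Function.update_of_ne hv]
        unfold family
        split_ifs with h1 h2 h3
        · rw [h1]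
        · rw [h2]
        · rw [h3]
        · rfl
    have h1 := hout (D := R' i) hRa hRb hRc hRE w hwW
    rw [heq] at h1
    have hzw : z ≠ w := by rintro rfl; exact hwW hz
    have := isWinner_iff.1 hw z hzw
    omega
  · intro hw
    by_cases hwx : w = x
    · subst hwx; exact ⟨_, hupd hF hA hBm hC hREm, hwinF⟩
    by_cases hwy : w = y
    · subst hwy; exact ⟨_, hupd hG hA hBm hC hREm, hwinG⟩
    by_cases hwz : w = z
    · subst hwz
      have hmA : Models (topBallot [w] (below W) N) (bottomResponses W w N SA) :=
        topBallot_bottomResponses (by simp [hw]) (fun _ _ h1 h2 _ => below_lt h1 h2)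
          (fun _ _ h1 h2 _ => by rw [below_of_notMem h1, below_of_notMem h2])
      have hmC : Models (topBallot [w] (below W) N.rev) (topResponses W w N SC) :=
        topBallot_topResponses (by simp [hw]) (fun _ _ => below_lt)
          (fun _ _ h1 h2 => by rw [below_of_notMem h1, below_of_notMem h2]) (below_of_mem hw)
          (fun b _ hb _ => by simp [hb.symm])
      have hmE : ∀ v : Fin n, Models (topBallot [w] (below W) N) (blockResponses W) := fun _ =>
        topBallot_blockResponses (by simp [hw]) fun _ _ => below_lt
      refine ⟨_, hupd hF hmA hBm hmC hmE, ?_⟩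
      refine hwin hmA hBm hmC hmE w hw fun w' hw' hne => Or.inl ?_
      rw [htot, htot]
      have h0 : ∀ M : Pref m, loss (topBallot [w] (below W) M) w = 0 := fun M => by
        rw [topBallot_loss (by simp) (by simp [below_of_mem hw]) (by simp)]; simp
      have h1 : 1 ≤ loss (topBallot [w] (below W) N) w' :=
        length_le_topBallot_loss (l := [w]) (by simp) (by simp [below_of_mem hw]) (by simp [hne])
      have h2 := hflat w' hw'
      have h3 := hflat w hw
      simp only [h0, Finset.sum_const_zero]
      omega
    -- To let another `w` win, `C` can be made to place it directly after `z`; `A` outweighs this by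
    -- putting `w` first and `z` last in `W`.
    · have hgz : belowLast W z z = 1 := by simp [belowLast]
      have hgW : ∀ v ∈ W, v ≠ z → belowLast W z v = 0 := fun v h1 h2 => by
        simp [belowLast, h1, h2]
      have hgU : ∀ v, v ∉ W → belowLast W z v = 2 := fun v h1 => by
        have : v ≠ z := by rintro rfl; exact h1 hz
        simp [belowLast, h1, this]
      have hglt : ∀ a b, a ∈ W → b ∉ W → belowLast W z a < belowLast W z b := by
        intro a b h1 h2
        rw [hgU b h2]
        by_cases h : a = z
        · subst h; omega
        · rw [hgW a h1 h]; omega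
      have hmA : Models (topBallot [w] (belowLast W z) N) (bottomResponses W z N SA) :=
        topBallot_bottomResponses (by simp [hw]) (fun a b h1 h2 _ => hglt a b h1 h2)
          (fun _ _ h1 h2 _ => by rw [hgU _ h1, hgU _ h2])
      have hmC : Models (topBallot [z, w] (below W) N.rev) (topResponses W z N SC) :=
        topBallot_topResponses (by simp [hw, hz]) (fun _ _ => below_lt)
          (fun _ _ h1 h2 => by rw [below_of_notMem h1, below_of_notMem h2]) (below_of_mem hz)
          (fun b _ hb _ => by simp [List.idxOf_cons, hb.symm])
      have hmE : ∀ v : Fin n, Models (topBallot [w] (below W) N) (blockResponses W) := fun _ =>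
        topBallot_blockResponses (by simp [hw]) fun _ _ => below_lt
      refine ⟨_, hupd hF hmA hBm hmC hmE, ?_⟩
      refine hwin hmA hBm hmC hmE w hw fun w' hw' hne => Or.inl ?_
      rw [htot, htot]
      have hgw := hgW w hw hwz
      have hzw : z ≠ w := Ne.symm hwz
      have h0 : loss (topBallot [w] (belowLast W z) N) w = 0 := by
        rw [topBallot_loss (by simp) (by simp [hgw]) (by simp)]; simp
      have h0' : loss (topBallot [w] (below W) N) w = 0 := by
        rw [topBallot_loss (by simp) (by simp [below_of_mem hw]) (by simp)]; simp
      have hC1 : loss (topBallot [z, w] (below W) N.rev) w = 1 :=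
        topBallot_pair_loss_snd hzw (below_of_mem hz) (below_of_mem hw)
      have h2 := hflat w' hw'
      have h3 := hflat w hw
      simp only [h0, h0', hC1, Finset.sum_const_zero]
      by_cases hw'z : w' = z
      · subst hw'z
        -- Since `w` is neither `x` nor `y`, one of these is a further member of `W` above `z` in
        -- `A`, so `z` loses at least two there.
        obtain ⟨q, hq, hqz, hqw⟩ : ∃ q ∈ W, q ≠ w' ∧ q ≠ w := by
          by_cases h : x = w'
          · exact ⟨y, hy, fun h' => hxy (h.trans h'.symm), Ne.symm hwy⟩
          · exact ⟨x, hx, h, Ne.symm hwx⟩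
        have h4 : 2 ≤ loss (topBallot [w] (belowLast W w') N) w' := by
          rw [← Finset.card_pair hqw]
          refine le_loss _ fun v hv => lev_of_lt ?_
          rw [Finset.mem_insert, Finset.mem_singleton] at hv
          rcases hv with rfl | rfl
          · simp only [hgW v hq hqz, hgz, List.idxOf_cons, List.idxOf_nil, cond_false,
              beq_eq_false_iff_ne.2 hqw.symm,
              beq_eq_false_iff_ne.2 hne.symm]
            omega
          · simp only [hgw, hgz, List.idxOf_cons_self]
            omega
        omega
      · have h4 : 1 ≤ loss (topBallot [w] (belowLast W z) N) w' :=
          length_le_topBallot_loss (l := [w]) (by simp) (by simp [hgw]) (by simp [hne])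
        have h5 : 2 ≤ loss (topBallot [z, w] (below W) N.rev) w' :=
          two_le_topBallot_pair_loss hzw (below_of_mem hz) (below_of_mem hw) hw'z hne
        omega

/-! ### Gains, rival pairs and the parity of the number of voters. -/

/-- The number of positions that `c` gains from `P` to `P'`. -/
def gain {m : ℕ} (P P' : Pref m) (c : Fin m) : ℤ := (loss P c : ℤ) - loss P' c

theorem gain_swap {m : ℕ} (P P' : Pref m) (c : Fin m) : gain P' P c = - gain P P' c := by
  unfold gain; ring

/-- Two possible winners `x`, `y` such that `y` gains most from `F` to `G`, and more than `x`;
`z` is the last possible winner according to `F`. -/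
structure Rivals {n m : ℕ} (T : Pref m) (Q : Fin n → Responses m) (i : Fin n)
    (W : Finset (Fin m)) (F G : Pref m) (x y z : Fin m) : Prop where
  voters : 4 ≤ n
  mem_iff : ∀ c, c ∈ W ↔ c ∈ possibleWinners T Q
  modelsF : Models F (Q i)
  modelsG : Models G (Q i)
  hx : x ∈ W
  hy : y ∈ W
  hz : z ∈ W
  last : ∀ w ∈ W, w = z ∨ F.prefers w z
  gain_le : ∀ w ∈ W, gain F G w ≤ gain F G y
  gain_lt : gain F G x < gain F G y

theorem Rivals.exists_world {n m : ℕ} {T : Pref m} {Q : Fin n → Responses m} {i : Fin n}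
    {W : Finset (Fin m)} {F G : Pref m} {x y z : Fin m} (h : Rivals T Q i W F G x y z)
    (N : Pref m) (SA SC : Finset (Fin m)) (hS : SA.card + SC.card ≤ 1)
    (hSA : ∀ u ∈ SA, ∃ c, F.prefers u c ∧ F.prefers c z) {A C : Pref m}
    (hA : Models A (bottomResponses W z N SA)) (hC : Models C (topResponses W z N SC))
    {d : ℕ} (hd : d ≤ 1) (hdxy : loss A x + loss C x + d = loss A y + loss C y)
    (hdw : ∀ w ∈ W, w ≠ x → w ≠ y → loss A y + loss C y < loss A w + loss C w)
    (hpar : (T.prefers x y ∧ Even (n + d)) ∨ (T.prefers y x ∧ Odd (n + d))) :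
    ∃ R, IsPossibleWorld T Q i R ∧ IsWinner T (Function.update R i F) x ∧
      IsWinner T (Function.update R i G) y := by
  have hle := h.gain_le
  have hlt := h.gain_lt
  unfold gain at hle hlt
  refine exists_world_of_ballots h.voters h.mem_iff h.modelsF h.modelsG h.hx h.hy ?_ h.hz h.last
    (fun w hw => ?_) (by omega) N SA SC hS hSA hA hC hd hdxy hdw hpar
  · rintro rfl; exact lt_irrefl _ hlt
  · have := hle w hw; omega

theorem Rivals.ne {n m : ℕ} {T : Pref m} {Q : Fin n → Responses m} {i : Fin n}
    {W : Finset (Fin m)} {F G : Pref m} {x y z : Fin m} (h : Rivals T Q i W F G x y z) :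
    x ≠ y := by
  rintro rfl; exact lt_irrefl _ h.gain_lt

theorem topBallot_below_bottom {m : ℕ} {W : Finset (Fin m)} {z : Fin m} {N : Pref m}
    {SA : Finset (Fin m)} {l : List (Fin m)} (hl : ∀ c ∈ l, c ∈ W) :
    Models (topBallot l (below W) N) (bottomResponses W z N SA) :=
  topBallot_bottomResponses hl (fun _ _ h1 h2 _ => below_lt h1 h2)
    (fun _ _ h1 h2 _ => by rw [below_of_notMem h1, below_of_notMem h2])

theorem topBallot_below_top {m : ℕ} {W : Finset (Fin m)} {z : Fin m} {N : Pref m}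
    {SC : Finset (Fin m)} {l : List (Fin m)} (hl : ∀ c ∈ l, c ∈ W) (hz : z ∈ W)
    (h : ∀ b ∈ W, b ≠ z → b ∉ SC → l.idxOf z < l.idxOf b) :
    Models (topBallot l (below W) N.rev) (topResponses W z N SC) :=
  topBallot_topResponses hl (fun _ _ => below_lt)
    (fun _ _ h1 h2 => by rw [below_of_notMem h1, below_of_notMem h2]) (below_of_mem hz) h

theorem idxOf_head_lt {m : ℕ} {z b : Fin m} {l : List (Fin m)} (h : b ≠ z) :
    (z :: l).idxOf z < (z :: l).idxOf b := by
  rw [List.idxOf_cons_self, List.idxOf_cons_ne _ h.symm]; omega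

/-- Opposite orders of `x` and `y` on top of `A` and `C` give margin `d = 0`. With `SC` empty `C`
must begin with `z`, which is allowed because `z` is one of the two. -/
theorem Rivals.exists_world_of_even {n m : ℕ} {T : Pref m} {Q : Fin n → Responses m} {i : Fin n}
    {W : Finset (Fin m)} {F G : Pref m} {x y z : Fin m} (h : Rivals T Q i W F G x y z)
    (hz : z = x ∨ z = y)
    (hpar : (T.prefers x y ∧ Even n) ∨ (T.prefers y x ∧ Odd n)) :
    ∃ R, IsPossibleWorld T Q i R ∧ IsWinner T (Function.update R i F) x ∧
      IsWinner T (Function.update R i G) y := by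
  have hxy := h.ne
  have hbx := below_of_mem h.hx
  have hby := below_of_mem h.hy
  have l1 := @topBallot_pair_loss_fst m (below W)
  have l2 := @topBallot_pair_loss_snd m (below W)
  have l3 := @two_le_topBallot_pair_loss m (below W)
  rcases hz with rfl | rfl
  · refine h.exists_world T ∅ ∅ (by simp) (by simp)
      (topBallot_below_bottom (l := [y, z]) (by simp [h.hx, h.hy]))
      (topBallot_below_top (l := [z, y]) (by simp [h.hx, h.hy]) h.hx
        fun b _ hb _ => idxOf_head_lt hb) (d := 0) (by omega) ?_ ?_ hpar
    · rw [l1 hxy hbx hby, l2 hxy hbx hby, l1 hxy.symm hby hbx, l2 hxy.symm hby hbx]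
    · intro w _ h1 h2
      rw [l2 hxy hbx hby, l1 hxy.symm hby hbx]
      have := l3 (N := T) hxy.symm hby hbx h2 h1
      omega
  · refine h.exists_world T ∅ ∅ (by simp) (by simp)
      (topBallot_below_bottom (l := [x, z]) (by simp [h.hx, h.hy]))
      (topBallot_below_top (l := [z, x]) (by simp [h.hx, h.hy]) h.hy
        fun b _ hb _ => idxOf_head_lt hb) (d := 0) (by omega) ?_ ?_ hpar
    · rw [l1 hxy hbx hby, l2 hxy hbx hby, l1 hxy.symm hby hbx, l2 hxy.symm hby hbx]
    · intro w _ h1 h2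
      rw [l2 hxy hbx hby, l1 hxy.symm hby hbx]
      have := l3 (N := T) hxy hbx hby h1 h2
      omega

/-- A third member of `W` provides margin `d = 1`: placed between the rivals in one ballot, it gives
`x` combined loss one and `y` two. If `z` is not a rival, it plays this part itself, and `SC = {x}`
permits `x` to stand above it. -/
theorem Rivals.exists_world_of_odd {n m : ℕ} {T : Pref m} {Q : Fin n → Responses m} {i : Fin n}
    {W : Finset (Fin m)} {F G : Pref m} {x y z : Fin m} (h : Rivals T Q i W F G x y z)
    (hW : 3 ≤ W.card)
    (hpar : (T.prefers x y ∧ Even (n + 1)) ∨ (T.prefers y x ∧ Odd (n + 1))) :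
    ∃ R, IsPossibleWorld T Q i R ∧ IsWinner T (Function.update R i F) x ∧
      IsWinner T (Function.update R i G) y := by
  have hxy := h.ne
  have hbx := below_of_mem h.hx
  have hby := below_of_mem h.hy
  have l1 := @topBallot_pair_loss_fst m (below W)
  have l2 := @topBallot_pair_loss_snd m (below W)
  have l3 := @two_le_topBallot_pair_loss m (below W)
  obtain ⟨w, hw, hwx, hwy⟩ : ∃ w ∈ W, w ≠ x ∧ w ≠ y := by
    by_contra hn
    push Not at hn
    have hsub : W ⊆ {x, y} := fun w hw => by
      rw [Finset.mem_insert, Finset.mem_singleton]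
      by_cases h1 : w = x
      · exact Or.inl h1
      · exact Or.inr (hn w hw h1)
    have := (Finset.card_le_card hsub).trans Finset.card_le_two
    omega
  have hbw := below_of_mem hw
  have htriple : ∀ N : Pref m, _ := fun N =>
    topBallot_triple_loss (N := N) hwx.symm hxy hwy hbx hbw hby
  by_cases hzx : z = x
  · subst hzx
    obtain ⟨t1, t2, t3, t4⟩ := htriple T.rev
    refine h.exists_world T ∅ ∅ (by simp) (by simp)
      (topBallot_below_bottom (l := [y, z]) (by simp [h.hx, h.hy]))
      (topBallot_below_top (l := [z, w, y]) (by simp [h.hx, h.hy, hw]) h.hx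
        fun b _ hb _ => idxOf_head_lt hb) (d := 1) (by omega) ?_ ?_ hpar
    · rw [l1 hxy.symm hby hbx, l2 hxy.symm hby hbx, t1, t3]
    · intro v _ h1 h2
      rw [l1 hxy.symm hby hbx, t3]
      have h3 := l3 (N := T) hxy.symm hby hbx h2 h1
      by_cases hvw : v = w
      · subst hvw; omega
      · have := t4 v h1 hvw h2; omega
  by_cases hzy : z = y
  · subst hzy
    obtain ⟨t1, t2, t3, t4⟩ := htriple T
    refine h.exists_world T ∅ ∅ (by simp) (by simp)
      (topBallot_below_bottom (l := [x, w, z]) (by simp [h.hx, h.hy, hw]))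
      (topBallot_below_top (l := [z, x]) (by simp [h.hx, h.hy]) h.hy
        fun b _ hb _ => idxOf_head_lt hb) (d := 1) (by omega) ?_ ?_ hpar
    · rw [l1 hxy.symm hby hbx, l2 hxy.symm hby hbx, t1, t3]
    · intro v _ h1 h2
      rw [l1 hxy.symm hby hbx, t3]
      have h3 := l3 (N := T.rev) hxy.symm hby hbx h2 h1
      by_cases hvw : v = w
      · subst hvw; omega
      · have := t4 v h1 hvw h2; omega
  · have hgz : belowLast W z z = 1 := by simp [belowLast]
    have hgW : ∀ v ∈ W, v ≠ z → belowLast W z v = 0 := fun v h1 h2 => by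
      simp [belowLast, h1, h2]
    have hgU : ∀ v, v ∉ W → belowLast W z v = 2 := fun v h1 => by
      have : v ≠ z := by rintro rfl; exact h1 h.hz
      simp [belowLast, h1, this]
    have hgx := hgW x h.hx (Ne.symm hzx)
    have hgy := hgW y h.hy (Ne.symm hzy)
    obtain ⟨t1, t2, t3, t4⟩ := topBallot_triple_loss (N := T.rev) (Ne.symm hzx) hxy hzy hbx
      (below_of_mem h.hz) hby
    have m1 := topBallot_pair_loss_fst (N := T) hxy.symm hgy hgx
    have m2 := topBallot_pair_loss_snd (N := T) hxy.symm hgy hgx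
    refine h.exists_world T ∅ {x} (by simp) (by simp)
      (topBallot_bottomResponses (l := [y, x]) (g := belowLast W z) (by simp [h.hx, h.hy])
        (fun a b h1 h2 _ => ?_) fun a b h1 h2 _ => by rw [hgU a h1, hgU b h2])
      (topBallot_below_top (l := [x, z, y]) (by simp [h.hx, h.hy, h.hz]) h.hz ?_)
      (d := 1) (by omega) ?_ ?_ hpar
    · rw [hgU b h2]
      by_cases h3 : a = z
      · subst h3; omega
      · rw [hgW a h1 h3]; omega
    · intro b _ hb hbx
      rw [Finset.mem_singleton] at hbx
      rw [List.idxOf_cons_ne _ (Ne.symm hzx), List.idxOf_cons_ne _ (Ne.symm hbx)]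
      exact Nat.succ_lt_succ (idxOf_head_lt hb)
    · rw [m1, m2, t1, t3]
    · intro v hv h1 h2
      rw [m1, t3]
      have h3 := two_le_topBallot_pair_loss (N := T) hxy.symm hgy hgx h2 h1
      by_cases hvz : v = z
      · subst hvz; omega
      · have := t4 v h1 hvz h2; omega

/-- Here `C` begins with `z`, and both rivals have combined loss two, so `z` must lose three in `A`.
When `W` has only three members, its last place costs only two; the outsider `u`, lifted above `z`
through `SA = {u}`, supplies the third. -/
theorem Rivals.exists_world_of_spacer {n m : ℕ} {T : Pref m} {Q : Fin n → Responses m}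
    {i : Fin n} {W : Finset (Fin m)} {F G : Pref m} {x y z u : Fin m}
    (h : Rivals T Q i W F G x y z) (hzx : z ≠ x) (hzy : z ≠ y) (hu : u ∉ W)
    (hspace : ∃ c, F.prefers u c ∧ F.prefers c z)
    (hpar : (T.prefers x y ∧ Even n) ∨ (T.prefers y x ∧ Odd n)) :
    ∃ R, IsPossibleWorld T Q i R ∧ IsWinner T (Function.update R i F) x ∧
      IsWinner T (Function.update R i G) y := by
  have hxy := h.ne
  have hbx := below_of_mem h.hx
  have hby := below_of_mem h.hy
  have hbz := below_of_mem h.hz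
  have huz : u ≠ z := by rintro rfl; exact hu h.hz
  -- Being first among the outsiders, `u` can pass `z` without disturbing the order prescribed for
  -- them.
  set N := lev (fun c => if c = u then 0 else 1) T with hN
  set g : Fin m → ℕ := fun c => if c = z then 2 else if c = u then 1 else
    if c ∈ W then 0 else 3 with hg
  have hgz : g z = 2 := by simp [hg]
  have hgu : g u = 1 := by simp [hg, huz]
  have hgW : ∀ v ∈ W, v ≠ z → g v = 0 := fun v h1 h2 => by
    have : v ≠ u := by rintro rfl; exact hu h1
    simp [hg, h1, h2, this]
  have hgU : ∀ v, v ∉ W → v ≠ u → g v = 3 := fun v h1 h2 => by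
    have : v ≠ z := by rintro rfl; exact h1 h.hz
    simp [hg, h1, h2, this]
  have hgx := hgW x h.hx hzx.symm
  have hgy := hgW y h.hy hzy.symm
  obtain ⟨t1, t2, t3, t4⟩ := topBallot_triple_loss (N := N.rev) hzx hzy hxy hbz hbx hby
  have m1 := topBallot_pair_loss_fst (N := N) hxy.symm hgy hgx
  have m2 := topBallot_pair_loss_snd (N := N) hxy.symm hgy hgx
  refine h.exists_world N {u} ∅ (by simp) (by simpa using hspace)
    (topBallot_bottomResponses (l := [y, x]) (g := g) (by simp [h.hx, h.hy])
      (fun a b h1 h2 h3 => ?_) (fun a b h1 h2 h3 => ?_))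
    (topBallot_below_top (l := [z, x, y]) (by simp [h.hx, h.hy, h.hz]) h.hz
      fun b _ hb _ => idxOf_head_lt hb)
    (d := 0) (by omega) ?_ ?_ hpar
  · rw [Finset.mem_singleton] at h3
    by_cases hbu : b = u
    · subst hbu
      rw [hgu, hgW a h1 fun h4 => h3 ⟨h4, rfl⟩]
      omega
    · rw [hgU b h2 hbu]
      by_cases h3 : a = z
      · subst h3; omega
      · rw [hgW a h1 h3]; omega
  · by_cases hbu : b = u
    · have h4 := le_of_lev h3
      have h5 : a = u := by
        by_contra h5
        simp [hbu, h5] at h4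
      rw [hbu, h5]
    · rw [hgU b h2 hbu]
      by_cases h5 : a = u
      · rw [h5]; omega
      · rw [hgU a h1 h5]
  · rw [m1, m2, t2, t3]
  · intro v hv h1 h2
    rw [m1, t3]
    by_cases hvz : v = z
    · subst hvz
      have h3 : 3 ≤ loss (topBallot [y, x] g N) v := by
        have hyu : y ≠ u := by rintro rfl; exact hu h.hy
        have hxu : x ≠ u := by rintro rfl; exact hu h.hx
        have hc : ({y, x, u} : Finset (Fin m)).card = 3 := by
          rw [Finset.card_insert_of_notMem (by simp [hxy.symm, hyu]), Finset.card_pair hxu]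
        rw [← hc]
        refine le_loss _ fun e he => lev_of_lt ?_
        have hlz : [y, x].idxOf v = 2 := List.idxOf_eq_length_iff.2 (by simp [h1, h2])
        have hle : [y, x].idxOf e ≤ 2 := List.idxOf_le_length (l := [y, x])
        simp only [Finset.mem_insert, Finset.mem_singleton] at he
        have hge : g e ≤ 1 := by
          rcases he with rfl | rfl | rfl
          · omega
          · omega
          · omega
        omega
      omega
    · have h3 := two_le_topBallot_pair_loss (N := N) hxy.symm hgy hgx h2 h1
      have := t4 v hvz h1 h2
      omega

/-- The alternatives are those for margin `d = 0` and margin `d = 1`. -/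
theorem parity_cases {m : ℕ} (T : Pref m) (n : ℕ) {x y : Fin m} (hxy : x ≠ y) :
    ((T.prefers x y ∧ Even n) ∨ (T.prefers y x ∧ Odd n)) ∨
      ((T.prefers x y ∧ Even (n + 1)) ∨ (T.prefers y x ∧ Odd (n + 1))) := by
  have h1 := T.prefers_or hxy
  have h2 := Nat.even_or_odd n
  rw [Nat.even_add_one, Nat.odd_add_one, Nat.not_even_iff_odd, Nat.not_odd_iff_even]
  tauto

/-- If `x` gains least and `y` gains most from `F` to `G`, then there is a possible world in which
`x` wins with `F` and `y` wins with `G`. -/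
theorem exists_world_of_extremal {n m : ℕ} {T : Pref m} {Q : Fin n → Responses m} {i : Fin n}
    (hn : 4 ≤ n) {F G : Pref m} (hF : Models F (Q i)) (hG : Models G (Q i)) {x y : Fin m}
    (hx : x ∈ possibleWinners T Q) (hy : y ∈ possibleWinners T Q)
    (hmin : ∀ w ∈ possibleWinners T Q, gain F G x ≤ gain F G w)
    (hmax : ∀ w ∈ possibleWinners T Q, gain F G w ≤ gain F G y)
    (hlt : gain F G x < gain F G y) :
    ∃ R, IsPossibleWorld T Q i R ∧ IsWinner T (Function.update R i F) x ∧
      IsWinner T (Function.update R i G) y := by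
  classical
  set W : Finset (Fin m) := Finset.univ.filter (· ∈ possibleWinners T Q) with hWdef
  have hW : ∀ c, c ∈ W ↔ c ∈ possibleWinners T Q := by simp [hWdef]
  have hxy : x ≠ y := by rintro rfl; exact lt_irrefl _ hlt
  obtain ⟨z, hz, hzl⟩ := F.exists_last (p := (· ∈ W)) ⟨x, (hW x).2 hx⟩
  obtain ⟨z', hz', hzl'⟩ := G.exists_last (p := (· ∈ W)) ⟨x, (hW x).2 hx⟩
  have r1 : Rivals T Q i W F G x y z := ⟨hn, hW, hF, hG, (hW x).2 hx, (hW y).2 hy, hz, hzl,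
    fun w hw => hmax w ((hW w).1 hw), hlt⟩
  -- Reading the change backwards makes `x` the one that gains most. This exchanges the roles in the
  -- tie-break, so for a fixed margin one of the two readings suits the parity of `n`.
  have r2 : Rivals T Q i W G F y x z' := ⟨hn, hW, hG, hF, (hW y).2 hy, (hW x).2 hx, hz', hzl',
    fun w hw => by
      have := hmin w ((hW w).1 hw)
      rw [gain_swap F G w, gain_swap F G x]; omega,
    by rw [gain_swap F G y, gain_swap F G x]; omega⟩
  have hflip : (∃ R, IsPossibleWorld T Q i R ∧ IsWinner T (Function.update R i G) y ∧
      IsWinner T (Function.update R i F) x) → ∃ R, IsPossibleWorld T Q i R ∧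
      IsWinner T (Function.update R i F) x ∧ IsWinner T (Function.update R i G) y := by
    rintro ⟨R, h1, h2, h3⟩; exact ⟨R, h1, h3, h2⟩
  have p1 := T.prefers_or hxy
  by_cases hcard : 3 ≤ W.card
  · have p2 := Nat.even_or_odd (n + 1)
    rcases p1 with p1 | p1 <;> rcases p2 with p2 | p2
    · exact r1.exists_world_of_odd hcard (Or.inl ⟨p1, p2⟩)
    · exact hflip (r2.exists_world_of_odd hcard (Or.inr ⟨p1, p2⟩))
    · exact hflip (r2.exists_world_of_odd hcard (Or.inl ⟨p1, p2⟩))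
    · exact r1.exists_world_of_odd hcard (Or.inr ⟨p1, p2⟩)
  -- With only two possible winners the last one is a rival in either reading, so margin `0` is
  -- available.
  · have hWxy : ∀ w ∈ W, w = x ∨ w = y := by
      intro w hw
      by_contra hne
      push Not at hne
      refine hcard (Finset.two_lt_card_iff.2 ⟨w, x, y, hw, (hW x).2 hx, (hW y).2 hy, hne.1, hne.2,
        hxy⟩)
    have p2 := Nat.even_or_odd n
    rcases p1 with p1 | p1 <;> rcases p2 with p2 | p2
    · exact r1.exists_world_of_even (hWxy z hz) (Or.inl ⟨p1, p2⟩)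
    · exact hflip (r2.exists_world_of_even (hWxy z' hz').symm (Or.inr ⟨p1, p2⟩))
    · exact hflip (r2.exists_world_of_even (hWxy z' hz').symm (Or.inl ⟨p1, p2⟩))
    · exact r1.exists_world_of_even (hWxy z hz) (Or.inr ⟨p1, p2⟩)

/-! ## Gains of the orders of minimal swap distance -/

/-- A lifted candidate passes exactly the nonmembers that stood above it. Together with the mirrored
count for nonmembers this shows that gains have opposite signs on the two sides and grow down the
order on each. -/
theorem gain_block_of_mem {m : ℕ} {P : Pref m} {H : Set (Fin m)} {c : Fin m} (hc : c ∈ H) :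
    ∃ U : Finset (Fin m), (∀ d, d ∈ U ↔ d ∉ H ∧ P.prefers d c) ∧
      gain P (block P H) c = U.card := by
  classical
  refine ⟨Finset.univ.filter fun d => d ∉ H ∧ P.prefers d c, by simp, ?_⟩
  have h : above P c = above (block P H) c ∪ Finset.univ.filter fun d => d ∉ H ∧ P.prefers d c := by
    ext d
    simp only [mem_above, Finset.mem_union, Finset.mem_filter, Finset.mem_univ, true_and,
      block_prefers]
    tauto
  have h' := congrArg Finset.card h
  rw [Finset.card_union_of_disjoint, ← loss_eq_card, ← loss_eq_card] at h'
  · unfold gain; omega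
  · rw [Finset.disjoint_left]
    intro d
    simp only [mem_above, Finset.mem_filter, Finset.mem_univ, true_and, block_prefers]
    tauto

theorem gain_block_of_notMem {m : ℕ} {P : Pref m} {H : Set (Fin m)} {c : Fin m} (hc : c ∉ H) :
    ∃ U : Finset (Fin m), (∀ d, d ∈ U ↔ d ∈ H ∧ P.prefers c d) ∧
      gain P (block P H) c = - U.card := by
  classical
  refine ⟨Finset.univ.filter fun d => d ∈ H ∧ P.prefers c d, by simp, ?_⟩
  have h : above (block P H) c = above P c ∪ Finset.univ.filter fun d => d ∈ H ∧ P.prefers c d := by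
    ext d
    simp only [mem_above, Finset.mem_union, Finset.mem_filter, Finset.mem_univ, true_and,
      block_prefers]
    by_cases hdc : d = c
    · subst hdc; simp [hc]
    · have := P.prefers_or hdc
      tauto
  have h' := congrArg Finset.card h
  rw [Finset.card_union_of_disjoint, ← loss_eq_card, ← loss_eq_card] at h'
  · unfold gain; omega
  · rw [Finset.disjoint_left]
    intro d
    simp only [mem_above, Finset.mem_filter, Finset.mem_univ, true_and]
    exact fun h1 h2 => h1.asymm h2.2

theorem gain_block_mono {m : ℕ} {P : Pref m} {H : Set (Fin m)} {c d : Fin m}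
    (hcd : c ∈ H ↔ d ∈ H) (h : P.prefers c d) :
    gain P (block P H) c ≤ gain P (block P H) d := by
  by_cases hc : c ∈ H
  · obtain ⟨U, hU, h1⟩ := gain_block_of_mem (P := P) hc
    obtain ⟨V, hV, h2⟩ := gain_block_of_mem (P := P) (hcd.1 hc)
    have : U.card ≤ V.card := Finset.card_le_card fun e he =>
      (hV e).2 ⟨((hU e).1 he).1, ((hU e).1 he).2.trans h⟩
    omega
  · obtain ⟨U, hU, h1⟩ := gain_block_of_notMem (P := P) hc
    obtain ⟨V, hV, h2⟩ := gain_block_of_notMem (P := P) (fun hd => hc (hcd.2 hd))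
    have : V.card ≤ U.card := Finset.card_le_card fun e he =>
      (hU e).2 ⟨((hV e).1 he).1, h.trans ((hV e).1 he).2⟩
    omega

theorem gain_block_nonneg {m : ℕ} {P : Pref m} {H : Set (Fin m)} {c : Fin m} (hc : c ∈ H) :
    0 ≤ gain P (block P H) c := by
  obtain ⟨U, _, h⟩ := gain_block_of_mem (P := P) hc
  omega

theorem gain_block_nonpos {m : ℕ} {P : Pref m} {H : Set (Fin m)} {c : Fin m} (hc : c ∉ H) :
    gain P (block P H) c ≤ 0 := by
  obtain ⟨U, _, h⟩ := gain_block_of_notMem (P := P) hc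
  omega

/-- The greatest gain belongs to the last possible winner in `H`, the least to the first outside
`H`. If all winners lie on one side, or these two stand in the harmful order, extremal gains
suffice. Otherwise all winners in `H` precede those outside, and one extreme is paired with a winner
from its own side. -/
theorem exists_worse_world {n m : ℕ} {T : Pref m} {Q : Fin n → Responses m} {i : Fin n}
    (hn : 4 ≤ n) {P : Pref m} {cj ck : Fin m} {H : Set (Fin m)} (hP : Models P (Q i))
    (hH : IsCut P (Q i) cj ck H) (hP' : Models (block P H) (Q i)) {a b : Fin m}
    (ha : a ∈ possibleWinners T Q) (hb : b ∈ possibleWinners T Q) (hab : P.prefers a b)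
    (hlt : gain P (block P H) a < gain P (block P H) b) :
    ∃ R x y, IsPossibleWorld T Q i R ∧ IsWinner T (Function.update R i P) x ∧
      IsWinner T (Function.update R i (block P H)) y ∧ P.prefers x y := by
  classical
  set e := gain P (block P H) with he
  have hne : ∀ {c d}, e c < e d → c ≠ d := by rintro c d h rfl; exact lt_irrefl _ h
  by_cases hmix : ∀ c ∈ possibleWinners T Q, ∀ d ∈ possibleWinners T Q, (c ∈ H ↔ d ∈ H)
  · obtain ⟨f, hf, hf'⟩ := P.exists_first (p := (· ∈ possibleWinners T Q)) ⟨a, ha⟩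
    obtain ⟨l, hl, hl'⟩ := P.exists_last (p := (· ∈ possibleWinners T Q)) ⟨a, ha⟩
    have hmin : ∀ w ∈ possibleWinners T Q, e f ≤ e w := by
      intro w hw
      rcases hf' w hw with rfl | h
      · exact le_rfl
      · exact gain_block_mono (hmix _ hf _ hw) h
    have hmax : ∀ w ∈ possibleWinners T Q, e w ≤ e l := by
      intro w hw
      rcases hl' w hw with rfl | h
      · exact le_rfl
      · exact gain_block_mono (hmix _ hw _ hl) h
    have hfl : e f < e l := ((hmin a ha).trans_lt hlt).trans_le (hmax b hb)
    obtain ⟨R, h1, h2, h3⟩ := exists_world_of_extremal hn hP hP' hf hl hmin hmax hfl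
    exact ⟨R, f, l, h1, h2, h3, (hf' l hl).resolve_left (hne hfl).symm⟩
  · push Not at hmix
    obtain ⟨hh, hhW, hhH, ll, hlW, hlH⟩ : ∃ c ∈ possibleWinners T Q, c ∈ H ∧
        ∃ d ∈ possibleWinners T Q, d ∉ H := by
      obtain ⟨c, hc, d, hd, h | h⟩ := hmix
      · exact ⟨c, hc, h.1, d, hd, h.2⟩
      · exact ⟨d, hd, h.2, c, hc, h.1⟩
    obtain ⟨hl, ⟨hl1, hl2⟩, hl3⟩ := P.exists_last
      (p := fun c => c ∈ possibleWinners T Q ∧ c ∈ H) ⟨hh, hhW, hhH⟩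
    obtain ⟨lf, ⟨lf1, lf2⟩, lf3⟩ := P.exists_first
      (p := fun c => c ∈ possibleWinners T Q ∧ c ∉ H) ⟨ll, hlW, hlH⟩
    have hmin : ∀ w ∈ possibleWinners T Q, e lf ≤ e w := by
      intro w hw
      by_cases hwH : w ∈ H
      · exact (gain_block_nonpos lf2).trans (gain_block_nonneg hwH)
      · rcases lf3 w ⟨hw, hwH⟩ with rfl | h
        · exact le_rfl
        · exact gain_block_mono (iff_of_false lf2 hwH) h
    have hmax : ∀ w ∈ possibleWinners T Q, e w ≤ e hl := by
      intro w hw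
      by_cases hwH : w ∈ H
      · rcases hl3 w ⟨hw, hwH⟩ with rfl | h
        · exact le_rfl
        · exact gain_block_mono (iff_of_true hwH hl2) h
      · exact (gain_block_nonpos hwH).trans (gain_block_nonneg hl2)
    have hfl : e lf < e hl := ((hmin a ha).trans_lt hlt).trans_le (hmax b hb)
    rcases P.prefers_or (hne hfl) with hord | hord
    · obtain ⟨R, h1, h2, h3⟩ := exists_world_of_extremal hn hP hP' lf1 hl1 hmin hmax hfl
      exact ⟨R, lf, hl, h1, h2, h3, hord⟩
    · set W : Finset (Fin m) := Finset.univ.filter (· ∈ possibleWinners T Q) with hWdef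
      have hW : ∀ c, c ∈ W ↔ c ∈ possibleWinners T Q := by simp [hWdef]
      by_cases haH : a ∈ H
      · have hea : e a < e hl := hlt.trans_le (hmax b hb)
        have hahl : P.prefers a hl := (hl3 a ⟨ha, haH⟩).resolve_left (hne hea)
        obtain ⟨z, hz, hz'⟩ := P.exists_last (p := (· ∈ W)) ⟨a, (hW a).2 ha⟩
        have hzhl : P.prefers hl z := by
          rcases hz' lf ((hW lf).2 lf1) with rfl | h
          · exact hord
          · exact hord.trans h
        have r : Rivals T Q i W P (block P H) a hl z := ⟨hn, hW, hP, hP', (hW a).2 ha,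
          (hW hl).2 hl1, hz, hz', fun w hw => hmax w ((hW w).1 hw), hea⟩
        have hza : z ≠ a := (hahl.trans hzhl).ne.symm
        -- `cj` will be the spacer. As `hl` has positive gain, some nonmember stands above it, hence
        -- so does `cj`; and `cj` is no possible winner, since it would precede `lf` outside `H`.
        have hjl : P.prefers cj hl := by
          obtain ⟨U, hU, hUe⟩ := gain_block_of_mem (P := P) hl2
          have h0 := gain_block_nonneg (P := P) haH
          have hpos : 0 < U.card := by
            have : gain P (block P H) a < gain P (block P H) hl := hea
            omega
          obtain ⟨d, hd⟩ := Finset.card_pos.1 hpos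
          rw [hU] at hd
          rcases hH.lower d hd.1 with rfl | h
          · exact hd.2
          · exact h.trans hd.2
        have hjW : cj ∉ W := by
          intro hj
          rcases lf3 cj ⟨(hW _).1 hj, hH.notMem⟩ with h | h
          · rw [h] at hjl; exact hjl.asymm hord
          · exact (hjl.trans (hord.trans h)).ne rfl
        have : ∃ R, IsPossibleWorld T Q i R ∧ IsWinner T (Function.update R i P) a ∧
            IsWinner T (Function.update R i (block P H)) hl := by
          rcases parity_cases T n (hne hea) with hp | hp
          · exact r.exists_world_of_spacer hza hzhl.ne.symm hjW ⟨hl, hjl, hzhl⟩ hp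
          · exact r.exists_world_of_odd (Finset.two_lt_card_iff.2 ⟨a, hl, z, (hW a).2 ha,
              (hW hl).2 hl1, hz, hne hea, hza.symm, hzhl.ne⟩) hp
        obtain ⟨R, h1, h2, h3⟩ := this
        exact ⟨R, a, hl, h1, h2, h3, hahl⟩
      · have hbH : b ∉ H := by
          intro hbH
          have h1 : P.prefers lf b := by
            rcases lf3 a ⟨ha, haH⟩ with rfl | h
            · exact hab
            · exact h.trans hab
          rcases hl3 b ⟨hb, hbH⟩ with rfl | h
          · exact h1.asymm hord
          · exact (h1.trans h).asymm hord
        obtain ⟨z, ⟨hz1, hz2⟩, hz3⟩ := P.exists_last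
          (p := fun c => c ∈ possibleWinners T Q ∧ c ∉ H) ⟨b, hb, hbH⟩
        have hez : e b ≤ e z := by
          rcases hz3 b ⟨hb, hbH⟩ with rfl | h
          · exact le_rfl
          · exact gain_block_mono (iff_of_false hbH hz2) h
        have hfz : e lf < e z := ((hmin a ha).trans_lt hlt).trans_le hez
        -- From `block P H` back to `P`, it is `lf` that gains most. The last winner outside `H` is
        -- also last in `block P H`, so it serves both as a rival and as the guard against
        -- outsiders.
        have r : Rivals T Q i W (block P H) P z lf z := by
          refine ⟨hn, hW, hP', hP, (hW z).2 hz1, (hW lf).2 lf1, (hW z).2 hz1, ?_, ?_, ?_⟩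
          · intro w hw
            by_cases hwH : w ∈ H
            · exact Or.inr (block_prefers.2 (Or.inl ⟨hwH, hz2⟩))
            · exact (hz3 w ⟨(hW w).1 hw, hwH⟩).imp_right fun h =>
                block_prefers.2 (Or.inr ⟨iff_of_false hwH hz2, h⟩)
          · intro w hw
            have h1 : gain P (block P H) lf ≤ gain P (block P H) w := hmin w ((hW w).1 hw)
            rw [gain_swap P _ w, gain_swap P _ lf]; omega
          · have h1 : gain P (block P H) lf < gain P (block P H) z := hfz
            rw [gain_swap P _ z, gain_swap P _ lf]; omega
        have hzlf : P.prefers lf z := (lf3 z ⟨hz1, hz2⟩).resolve_left (hne hfz).symm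
        have : ∃ R, IsPossibleWorld T Q i R ∧ IsWinner T (Function.update R i (block P H)) z ∧
            IsWinner T (Function.update R i P) lf := by
          rcases parity_cases T n (hne hfz).symm with hp | hp
          · exact r.exists_world_of_even (Or.inl rfl) hp
          · exact r.exists_world_of_odd (Finset.two_lt_card_iff.2 ⟨lf, hl, z, (hW lf).2 lf1,
              (hW hl).2 hl1, (hW z).2 hz1, hne hfl, hne hfz, (hord.trans hzlf).ne⟩) hp
        obtain ⟨R, h1, h2, h3⟩ := this
        exact ⟨R, lf, z, h1, h3, h2, hzlf⟩

/-! ## The test for local dominance -/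

/-- The other ballots contribute equally before and after. If `x` did not gain more, both
comparisons would have to be ties, which `T` cannot resolve in opposite ways. -/
theorem gain_lt_of_winners {n m : ℕ} {T : Pref m} {R : Fin n → Pref m} {i : Fin n}
    {P P' : Pref m} {x y : Fin m} (hx : IsWinner T (Function.update R i P') x)
    (hy : IsWinner T (Function.update R i P) y) (hxy : x ≠ y) : gain P P' y < gain P P' x := by
  by_contra hn
  rw [isWinner_iff] at hx hy
  have h1 := hx y hxy.symm
  have h2 := hy x hxy
  rw [totalLoss_update, totalLoss_update] at h1 h2
  unfold gain at hn
  rcases h1 with h1 | ⟨h1, h1'⟩ <;> rcases h2 with h2 | ⟨h2, h2'⟩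
  · omega
  · omega
  · omega
  · exact h1'.asymm h2'

theorem scanT_fst {m : ℕ} (P P' : Pref m) (a : Fin m) (l : List (Fin m)) :
    (scanT P.order P'.order a l).val.1 = true ↔
      (a :: l).IsChain fun c d => P'.prefers c d ∧ gain P P' d ≤ gain P P' c := by
  induction l generalizing a with
  | nil => simp [scanT]
  | cons b l ih =>
    simp only [scanT, Timed.val_bind, Timed.val_pure, indexT_val, Bool.and_eq_true,
      decide_eq_true_eq, List.isChain_cons_cons, ih]
    refine and_congr_left fun _ => ?_
    refine and_congr_right fun _ => ?_
    unfold gain loss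
    omega

theorem scanT_snd {m : ℕ} (P P' : Pref m) (a : Fin m) (l : List (Fin m)) :
    (scanT P.order P'.order a l).val.2 = true ↔
      ¬ (a :: l).IsChain fun c d => gain P P' c ≤ gain P P' d := by
  induction l generalizing a with
  | nil => simp [scanT]
  | cons b l ih =>
    simp only [scanT, Timed.val_bind, Timed.val_pure, indexT_val, Bool.or_eq_true,
      decide_eq_true_eq, List.isChain_cons_cons, ih]
    rw [Classical.not_and_iff_not_or_not]
    refine or_congr ?_ Iff.rfl
    unfold gain loss
    omega

/-- The interval from `c` to `d` grows by `gain P P' c - gain P P' d`. Decreasing gains also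
preserve the order of the possible winners. -/
theorem isLDT_iff {m : ℕ} {P P' : Pref m} {pw : List (Fin m)} (hpw : pw.Pairwise P.prefers) :
    (isLDT P.order P'.order pw).val = true ↔
      (∀ c ∈ pw, ∀ d ∈ pw, P.prefers c d → gain P P' d ≤ gain P P' c) ∧
      ∃ c ∈ pw, ∃ d ∈ pw, gain P P' c ≠ gain P P' d := by
  cases pw with
  | nil => simp [isLDT]
  | cons a l =>
    simp only [isLDT, Timed.val_bind, Timed.val_pure, Bool.and_eq_true, scanT_fst, scanT_snd]
    have t1 : IsTrans (Fin m) fun c d => gain P P' d ≤ gain P P' c :=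
      ⟨fun _ _ _ h1 h2 => h2.trans h1⟩
    have t2 : IsTrans (Fin m) fun c d => gain P P' c ≤ gain P P' d :=
      ⟨fun _ _ _ h1 h2 => h1.trans h2⟩
    have hmono : ∀ {r : Fin m → Fin m → Prop}, (a :: l).Pairwise r →
        ∀ c ∈ a :: l, ∀ d ∈ a :: l, P.prefers c d → r c d := by
      intro r hr c hc d hd hcd
      refine pairwise_of_idxOf_lt hr hd ?_
      rcases lt_trichotomy ((a :: l).idxOf c) ((a :: l).idxOf d) with h | h | h
      · exact h
      · exact absurd ((List.idxOf_inj hc).1 h) hcd.ne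
      · exact absurd hcd (pairwise_of_idxOf_lt hpw hc h).asymm
    constructor
    · rintro ⟨h1, h2⟩
      have h1' := List.isChain_iff_pairwise.1 (h1.imp fun c d h => h.2)
      refine ⟨hmono h1', ?_⟩
      by_contra hn
      push Not at hn
      refine h2 (List.isChain_iff_pairwise.2 ?_)
      exact hpw.imp_of_mem fun hc hd _ => (hn _ hc _ hd).le
    · rintro ⟨h1, c, hc, d, hd, hne⟩
      refine ⟨?_, fun h2 => hne ?_⟩
      · refine List.Pairwise.isChain (hpw.imp_of_mem fun {u v} hu hv huv => ?_)
        have h3 := h1 u hu v hv huv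
        refine ⟨?_, h3⟩
        have h4 : loss P u < loss P v := huv
        have h5 : loss P' u < loss P' v := by unfold gain at h3; omega
        exact h5
      · have h2' := hmono (List.isChain_iff_pairwise.1 h2)
        have hcd : c ≠ d := by rintro rfl; exact hne rfl
        rcases P.prefers_or hcd with h | h
        · exact le_antisymm (h2' c hc d hd h) (h1 c hc d hd h)
        · exact le_antisymm (h1 d hd c hc h) (h2' d hd c hc h)

/-- The first and last possible winners have the extreme gains, so an improving world exists; a
harmful one would need a lower-ranked winner that gains more. -/
theorem locallyDominant_of_isLDT {n m : ℕ} {T : Pref m} {Q : Fin n → Responses m} {i : Fin n}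
    (hn : 4 ≤ n) {P P' : Pref m} (hP : Models P (Q i)) (hP' : Models P' (Q i))
    {pw : List (Fin m)} (hpw : pw.Pairwise P.prefers)
    (hmem : ∀ c, c ∈ pw ↔ c ∈ possibleWinners T Q)
    (h : (isLDT P.order P'.order pw).val = true) : LocallyDominant T Q i P P' := by
  rw [isLDT_iff hpw] at h
  obtain ⟨hanti, c, hc, d, hd, hcd⟩ := h
  simp only [hmem] at hanti hc hd
  constructor
  · obtain ⟨f, hf, hf'⟩ := P.exists_first (p := (· ∈ possibleWinners T Q)) ⟨c, hc⟩
    obtain ⟨l, hl, hl'⟩ := P.exists_last (p := (· ∈ possibleWinners T Q)) ⟨c, hc⟩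
    have hmax : ∀ w ∈ possibleWinners T Q, gain P P' w ≤ gain P P' f := by
      intro w hw
      rcases hf' w hw with rfl | h
      · exact le_rfl
      · exact hanti f hf w hw h
    have hmin : ∀ w ∈ possibleWinners T Q, gain P P' l ≤ gain P P' w := by
      intro w hw
      rcases hl' w hw with rfl | h
      · exact le_rfl
      · exact hanti w hw l hl h
    have hlt : gain P P' l < gain P P' f := by
      have h1 := hmax c hc
      have h2 := hmax d hd
      have h3 := hmin c hc
      have h4 := hmin d hd
      omega
    obtain ⟨R, h1, h2, h3⟩ := exists_world_of_extremal hn hP hP' hl hf hmin hmax hlt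
    refine ⟨R, h1, f, l, h3, h2, (hf' l hl).resolve_left ?_⟩
    rintro rfl
    exact lt_irrefl _ hlt
  · intro R hR x y hx hy hyx
    have h1 := gain_lt_of_winners hx hy hyx.ne.symm
    have h2 := hanti y (hR.winner_mem hP hy) x (hR.winner_mem hP' hx) hyx
    omega

/-- Here the block form matters: it turns any failure of monotonicity into a harmful world. The
improving world rules out constant gains. -/
theorem isLDT_of_locallyDominant {n m : ℕ} {T : Pref m} {Q : Fin n → Responses m} {i : Fin n}
    (hn : 4 ≤ n) {P : Pref m} {cj ck : Fin m} {H : Set (Fin m)} (hP : Models P (Q i))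
    (hH : IsCut P (Q i) cj ck H) (hP' : Models (block P H) (Q i))
    {pw : List (Fin m)} (hpw : pw.Pairwise P.prefers)
    (hmem : ∀ c, c ∈ pw ↔ c ∈ possibleWinners T Q)
    (h : LocallyDominant T Q i P (block P H)) :
    (isLDT P.order (block P H).order pw).val = true := by
  rw [isLDT_iff hpw]
  simp only [hmem]
  constructor
  · intro c hc d hd hcd
    by_contra hlt
    obtain ⟨R, x, y, hR, hx, hy, hxy⟩ :=
      exists_worse_world hn hP hH hP' hc hd hcd (not_le.1 hlt)
    exact h.2 R hR y x hy hx hxy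
  · obtain ⟨R, hR, x, y, hx, hy, hxy⟩ := h.1
    exact ⟨x, hR.winner_mem hP' hx, y, hR.winner_mem hP hy,
      (gain_lt_of_winners hx hy hxy.ne).ne'⟩

/-- If the preliminary condition fails, all winners lie below `ck` or all lie above `cj`, where
gains vanish, or the first is not below `cj` and the last not above `ck`, so that the first gains at
most zero and the last at least zero. Each case contradicts the test. -/
theorem feasibleT_of_isLDT {m : ℕ} {P : Pref m} {Q : Responses m} {cj ck : Fin m}
    {H : Set (Fin m)} (hjk : P.prefers cj ck) (hH : IsCut P Q cj ck H) {pw : List (Fin m)}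
    (hpw : pw.Pairwise P.prefers) (h : (isLDT P.order (block P H).order pw).val = true) :
    (feasibleT P.order cj ck pw).val = true := by
  rw [isLDT_iff hpw] at h
  obtain ⟨hanti, c, hc, d, hd, hcd⟩ := h
  cases pw with
  | nil => simp at hc
  | cons a l =>
    set z := (a :: l).getLast (List.cons_ne_nil a l) with hz
    have ha : ∀ c ∈ a :: l, c = a ∨ P.prefers a c := by
      intro c hc
      rcases List.mem_cons.1 hc with h | h
      · exact Or.inl h
      · exact Or.inr ((List.pairwise_cons.1 hpw).1 c h)
    have hzmem : z ∈ a :: l := List.getLast_mem _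
    have hzl : ∀ c ∈ a :: l, c = z ∨ P.prefers c z := by
      intro c hc
      have h1 : (a :: l).dropLast ++ [z] = a :: l := List.dropLast_append_getLast _
      rw [← h1, List.pairwise_append] at hpw
      rw [← h1, List.mem_append, List.mem_singleton] at hc
      rcases hc with hc | hc
      · exact Or.inr (hpw.2.2 c hc z (by simp))
      · exact Or.inl hc
    have ham : a ∈ a :: l := List.mem_cons_self
    have hmax : ∀ w ∈ a :: l, gain P (block P H) w ≤ gain P (block P H) a := by
      intro w hw
      rcases ha w hw with rfl | h
      · exact le_rfl
      · exact hanti a ham w hw h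
    have hmin : ∀ w ∈ a :: l, gain P (block P H) z ≤ gain P (block P H) w := by
      intro w hw
      rcases hzl w hw with h | h
      · rw [h]
      · exact hanti w hw z hzmem h
    have hlt : gain P (block P H) z < gain P (block P H) a := by
      have h1 := hmax c hc
      have h2 := hmax d hd
      have h3 := hmin c hc
      have h4 := hmin d hd
      omega
    have haz : P.prefers a z := (ha z hzmem).resolve_left fun h => by
      rw [h] at hlt; exact lt_irrefl _ hlt
    have hval : (feasibleT P.order cj ck (a :: l)).val = true ↔
        ((P.prefers cj a ∧ P.prefers z ck) ∨
        (P.prefers cj a ∧ ¬ P.prefers ck a ∧ ¬ P.prefers z ck)) ∨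
        (P.prefers z ck ∧ ¬ P.prefers cj a ∧ ¬ P.prefers z cj) := by
      simp only [feasibleT, Timed.val_bind, Timed.val_pure, lastT_val, beforeT_val, ← hz,
        Bool.or_eq_true, Bool.and_eq_true, decide_eq_true_eq, Bool.not_eq_true',
        decide_eq_false_iff_not]
    rw [hval]
    by_contra hn
    by_cases hja : P.prefers cj a
    · have hka : P.prefers ck a := by
        by_contra hka
        by_cases hzk : P.prefers z ck
        · exact hn (Or.inl (Or.inl ⟨hja, hzk⟩))
        · exact hn (Or.inl (Or.inr ⟨hja, hka, hzk⟩))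
      have hlow : ∀ w, P.prefers ck w → gain P (block P H) w = 0 := by
        intro w hw
        have hwH : w ∉ H := fun hwH => by
          rcases hH.upper w hwH with rfl | h
          · exact hw.ne rfl
          · exact h.asymm hw
        obtain ⟨U, hU, hUe⟩ := gain_block_of_notMem (P := P) hwH
        have : U = ∅ := by
          rw [Finset.eq_empty_iff_forall_notMem]
          intro e he
          rw [hU] at he
          rcases hH.upper e he.1 with rfl | h
          · exact hw.asymm he.2
          · exact (h.trans hw).asymm he.2
        rw [hUe, this]; simp
      rw [hlow a hka, hlow z (hka.trans haz)] at hlt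
      exact lt_irrefl _ hlt
    · have hupper : ∀ w, P.prefers w cj → gain P (block P H) w = 0 := by
        intro w hw
        have hwH : w ∈ H := by
          by_contra hwH
          rcases hH.lower w hwH with rfl | h
          · exact hw.ne rfl
          · exact h.asymm hw
        obtain ⟨U, hU, hUe⟩ := gain_block_of_mem (P := P) hwH
        have : U = ∅ := by
          rw [Finset.eq_empty_iff_forall_notMem]
          intro e he
          rw [hU] at he
          rcases hH.lower e he.1 with rfl | h
          · exact hw.asymm he.2
          · exact (h.trans he.2).asymm hw
        rw [hUe, this]; simp
      by_cases hzk : P.prefers z ck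
      · have hzj : P.prefers z cj := by_contra fun hzj => hn (Or.inr ⟨hzk, hja, hzj⟩)
        rw [hupper a (haz.trans hzj), hupper z hzj] at hlt
        exact lt_irrefl _ hlt
      · have h1 : gain P (block P H) a ≤ 0 := by
          rcases P.not_prefers_iff.1 hja with h | h
          · rw [← h]; exact gain_block_nonpos hH.notMem
          · exact (hupper a h).le
        have h2 : 0 ≤ gain P (block P H) z := by
          rcases P.not_prefers_iff.1 hzk with h | h
          · rw [h]; exact gain_block_nonneg hH.mem
          · have hzH : z ∉ H ∨ z ∈ H := (em _).symm
            rcases hzH with hzH | hzH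
            · obtain ⟨U, hU, hUe⟩ := gain_block_of_notMem (P := P) hzH
              have : U = ∅ := by
                rw [Finset.eq_empty_iff_forall_notMem]
                intro e he
                rw [hU] at he
                rcases hH.upper e he.1 with rfl | h'
                · exact h.asymm he.2
                · exact (h'.trans h).asymm he.2
              rw [hUe, this]; simp
            · exact gain_block_nonneg hzH
        omega

/-! ## The loop -/

/-- Invariant: `D` bounds both recorded distances from below, and the stored order is good once
`dloc` equals `D`. A passing pivot at distance `D` makes `dloc` end there, so the final comparison
cannot fall back on `P`. -/
theorem loopT_val {m : ℕ} {P : List (Fin m)} {q : List (Fin m × Fin m)} {pw : List (Fin m)}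
    {cj ck : Fin m} {D : ℕ} {good : List (Fin m) → Prop} {Z : List (Fin m)}
    {dabs dloc : WithTop ℕ} {Ploc : List (Fin m)}
    (hgood : ∀ z ∈ Z, (isLDT P (buildT P q cj ck z).val pw).val = true →
      (swapDistT P (buildT P q cj ck z).val).val = D → good (buildT P q cj ck z).val)
    (hD : ∀ z ∈ Z, D ≤ (swapDistT P (buildT P q cj ck z).val).val)
    (habs : (D : WithTop ℕ) ≤ dabs) (hloc : (D : WithTop ℕ) ≤ dloc)
    (hP : dloc = (D : WithTop ℕ) → good Ploc)
    (hex : dloc = (D : WithTop ℕ) ∨ ∃ z ∈ Z,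
      (isLDT P (buildT P q cj ck z).val pw).val = true ∧
      (swapDistT P (buildT P q cj ck z).val).val = D) :
    good (loopT P q pw cj ck dabs dloc Ploc Z).val := by
  induction Z generalizing dabs dloc Ploc with
  | nil =>
    have h : dloc = (D : WithTop ℕ) := by simpa using hex
    simp only [loopT, Timed.val_bind, Timed.val_pure]
    rw [if_neg (by rw [h]; exact not_lt.2 habs)]
    exact hP h
  | cons z Z ih =>
    simp only [loopT, Timed.val_bind]
    set L := (buildT P q cj ck z).val with hL
    set d := (swapDistT P L).val with hd
    have hDd : (D : WithTop ℕ) ≤ (d : WithTop ℕ) := by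
      exact_mod_cast hD z List.mem_cons_self
    have habs' : (D : WithTop ℕ) ≤ if (d : WithTop ℕ) < dabs then (d : WithTop ℕ) else dabs := by
      split_ifs
      · exact hDd
      · exact habs
    have hgood' := fun w hw => hgood w (List.mem_cons_of_mem z hw)
    have hD' := fun w hw => hD w (List.mem_cons_of_mem z hw)
    generalize (if (d : WithTop ℕ) < dabs then (d : WithTop ℕ) else dabs) = dabs' at habs'
    by_cases hc : (isLDT P L pw).val = true ∧ (d : WithTop ℕ) < dloc
    · rw [if_pos hc]
      refine ih hgood' hD' habs' hDd (fun h => ?_) ?_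
      · exact hgood z List.mem_cons_self hc.1 (WithTop.coe_eq_coe.1 h)
      · rcases hex with h | ⟨w, hw, h1, h2⟩
        · exact absurd (h ▸ hc.2) (not_lt.2 hDd)
        · rcases List.mem_cons.1 hw with hwz | hw
          · subst hwz
            exact Or.inl (congrArg _ h2)
          · exact Or.inr ⟨w, hw, h1, h2⟩
    · rw [if_neg hc]
      refine ih hgood' hD' habs' hloc hP ?_
      rcases hex with h | ⟨w, hw, h1, h2⟩
      · exact Or.inl h
      · rcases List.mem_cons.1 hw with hwz | hw
        · subst hwz
          refine Or.inl (le_antisymm ?_ hloc)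
          rw [← h2]
          exact not_lt.1 fun h => hc ⟨h1, h⟩
        · exact Or.inr ⟨w, hw, h1, h2⟩

theorem metaAlgorithm_correct {n m : ℕ} {T : Pref m} {Q : Fin n → Responses m} {i : Fin n}
    {P : Pref m} {q : List (Fin m × Fin m)} {pw : List (Fin m)} {cj ck : Fin m} (hn : 4 ≤ n)
    (hg : CommonGivens T Q i P q pw cj ck) {P' : Pref m} (hLD : LocallyDominant T Q i P P')
    (hmu : P' ∈ mu (Q i) P cj ck) :
    ∃ P', (metaAlgorithm P.order q pw cj ck).val = P'.order ∧
      LocallyDominant T Q i P P' ∧ P' ∈ mu (Q i) P cj ck := by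
  have hP := hg.consistent
  have hjk := hg.query
  have hbuild := fun z hz hz' => buildT_val (z := z) hP hg.closure_mem hjk hg.uncommitted.1 hz hz'
  have hpm := fun z hz hz' => pivot_models (z := z) hP hjk hg.uncommitted.1 hz hz'
  have hsub : ∀ {P' : Pref m}, Models P' (Q i ∪ {(ck, cj)}) → Models P' (Q i) := fun h =>
    h.mono Set.subset_union_left
  obtain ⟨z, hz, hz', hPz⟩ := exists_pivot_of_mem_mu hP hjk hmu
  obtain ⟨H, hH, hPH⟩ := exists_isCut_of_mem_mu hP hjk hmu
  have htest : (isLDT P.order P'.order pw).val = true := by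
    rw [hPH] at hLD ⊢
    exact isLDT_of_locallyDominant hn hP hH (hPH ▸ hsub hmu.1) hg.pw_sorted hg.pw_mem hLD
  have hfeas : (feasibleT P.order cj ck pw).val = true := by
    rw [hPH] at htest
    exact feasibleT_of_isLDT hjk hH hg.pw_sorted htest
  have has : ∀ a b, P.prefers a b → ¬ P.prefers b a := fun a b h => h.asymm
  have hZ : ∀ w, w ∈ (uptoT ck (fromT cj P.order).val).val ↔
      (w = cj ∨ P.prefers cj w) ∧ (w = ck ∨ P.prefers w ck) := by
    intro w
    have h1 : ∀ w, w ∈ (fromT cj P.order).val ↔ w = cj ∨ P.prefers cj w := fun w => by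
      rw [mem_fromT has P.pairwise_order (P.complete cj)]; simp [P.complete w]
    rw [mem_uptoT has (P.pairwise_order.sublist (fromT_sublist _ _)) ((h1 ck).2 (Or.inr hjk)), h1]
  have hval : (metaAlgorithm P.order q pw cj ck).val =
      (loopT P.order q pw cj ck ⊤ ⊤ P.order (uptoT ck (fromT cj P.order).val).val).val := by
    simp only [metaAlgorithm, Timed.val_bind, hfeas, if_true]
  rw [hval]
  -- The given `P'` attains the minimum, so every pivot order at this distance lies in `mu`, and the
  -- test certifies its dominance.
  refine loopT_val (D := swapDist P P') (good := fun L => ∃ P', L = P'.order ∧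
      LocallyDominant T Q i P P' ∧ P' ∈ mu (Q i) P cj ck) ?_ ?_ le_top le_top ?_ ?_
  · intro w hw h1 h2
    rw [hZ] at hw
    rw [hbuild w hw.1 hw.2] at h1 h2 ⊢
    rw [swapDistT_val] at h2
    have hm := hpm w hw.1 hw.2
    refine ⟨_, rfl, locallyDominant_of_isLDT hn hP (hsub hm) hg.pw_sorted hg.pw_mem h1, hm, ?_⟩
    intro P'' hP''
    rw [h2]
    exact hmu.2 P'' hP''
  · intro w hw
    rw [hZ] at hw
    rw [hbuild w hw.1 hw.2, swapDistT_val]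
    exact hmu.2 _ (hpm w hw.1 hw.2)
  · intro h
    exact absurd h (WithTop.top_ne_coe)
  · refine Or.inr ⟨z, (hZ z).2 ⟨hz, hz'⟩, ?_⟩
    rw [hbuild z hz hz', ← hPz, swapDistT_val]
    exact ⟨htest, rfl⟩

/-! ## Running time -/

theorem memT_time {m : ℕ} (p : Fin m × Fin m) (l : List (Fin m × Fin m)) :
    (memT p l).time ≤ l.length + 1 := by
  induction l with
  | nil => simp [memT]
  | cons x l ih =>
    simp only [memT, Timed.time_bind, time_tick, List.length_cons]
    split_ifs
    · simp
    · omega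

theorem indexT_time {m : ℕ} (c : Fin m) (l : List (Fin m)) :
    (indexT c l).time ≤ l.length + 1 := by
  induction l with
  | nil => simp [indexT]
  | cons x l ih =>
    simp only [indexT, Timed.time_bind, time_tick, List.length_cons]
    split_ifs
    · simp
    · simp only [Timed.time_bind, Timed.time_pure]; omega

theorem beforeT_time {m : ℕ} (a b : Fin m) (P : List (Fin m)) :
    (beforeT a b P).time ≤ 2 * P.length + 3 := by
  have h1 := indexT_time a P
  have h2 := indexT_time b P
  simp only [beforeT, Timed.time_bind, time_tick, Timed.time_pure]
  omega

theorem lastT_time {m : ℕ} (a : Fin m) (l : List (Fin m)) :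
    (lastT a l).time ≤ l.length + 1 := by
  induction l generalizing a with
  | nil => simp [lastT]
  | cons b l ih =>
    have := ih b
    simp only [lastT, Timed.time_bind, time_tick, List.length_cons]
    omega

theorem aboveT_time {m : ℕ} (z : Fin m) (l : List (Fin m)) :
    (aboveT z l).time ≤ l.length + 1 := by
  induction l with
  | nil => simp [aboveT]
  | cons x l ih =>
    simp only [aboveT, Timed.time_bind, time_tick, List.length_cons]
    split_ifs
    · simp
    · simp only [Timed.time_bind, Timed.time_pure]; omega

theorem fromT_time {m : ℕ} (z : Fin m) (l : List (Fin m)) :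
    (fromT z l).time ≤ l.length + 1 := by
  induction l with
  | nil => simp [fromT]
  | cons x l ih =>
    simp only [fromT, Timed.time_bind, time_tick, List.length_cons]
    split_ifs
    · simp
    · omega

theorem uptoT_time {m : ℕ} (z : Fin m) (l : List (Fin m)) :
    (uptoT z l).time ≤ l.length + 1 := by
  induction l with
  | nil => simp [uptoT]
  | cons x l ih =>
    simp only [uptoT, Timed.time_bind, time_tick, List.length_cons]
    split_ifs
    · simp
    · simp only [Timed.time_bind, Timed.time_pure]; omega

theorem filterT_time {m : ℕ} {f : Fin m → Timed Bool} {K : ℕ} (hf : ∀ x, (f x).time ≤ K)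
    (l : List (Fin m)) : (filterT f l).time ≤ l.length * (K + 1) + 1 := by
  induction l with
  | nil => simp [filterT]
  | cons x l ih =>
    have := hf x
    simp only [filterT, Timed.time_bind, time_tick, Timed.time_pure, List.length_cons, add_mul]
    omega

theorem appendT_time {m : ℕ} (l' l : List (Fin m)) :
    (appendT l' l).time ≤ l.length + 1 := by
  induction l with
  | nil => simp [appendT]
  | cons x l ih =>
    simp only [appendT, Timed.time_bind, time_tick, Timed.time_pure, List.length_cons]
    omega

theorem countBeforeT_time {m : ℕ} (P : List (Fin m)) (x : Fin m) (l : List (Fin m)) :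
    (countBeforeT P x l).time ≤ l.length * (2 * P.length + 4) + 1 := by
  induction l with
  | nil => simp [countBeforeT]
  | cons y l ih =>
    have := beforeT_time y x P
    simp only [countBeforeT, Timed.time_bind, time_tick, Timed.time_pure, List.length_cons,
      add_mul l.length 1, one_mul]
    omega

theorem swapDistT_time {m : ℕ} (P l : List (Fin m)) {K : ℕ} (hK : l.length ≤ K) :
    (swapDistT P l).time ≤ l.length * (K * (2 * P.length + 4) + 2) + 1 := by
  induction l with
  | nil => simp [swapDistT]
  | cons x l ih =>
    rw [List.length_cons] at hK
    have h1 := ih (by omega)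
    have h2 := countBeforeT_time P x l
    have h3 : l.length * (2 * P.length + 4) ≤ K * (2 * P.length + 4) :=
      Nat.mul_le_mul_right _ (by omega)
    simp only [swapDistT, Timed.time_bind, time_tick, Timed.time_pure, List.length_cons,
      add_mul l.length 1, one_mul]
    omega

theorem scanT_time {m : ℕ} (P P' : List (Fin m)) (a : Fin m) (l : List (Fin m)) :
    (scanT P P' a l).time ≤ l.length * (2 * P.length + 2 * P'.length + 5) + 1 := by
  induction l generalizing a with
  | nil => simp [scanT]
  | cons b l ih =>
    have h := ih b
    have h1 := indexT_time a P
    have h2 := indexT_time b P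
    have h3 := indexT_time a P'
    have h4 := indexT_time b P'
    simp only [scanT, Timed.time_bind, time_tick, Timed.time_pure, List.length_cons,
      add_mul l.length 1, one_mul]
    omega

theorem isLDT_time {m : ℕ} (P P' pw : List (Fin m)) :
    (isLDT P P' pw).time ≤ pw.length * (2 * P.length + 2 * P'.length + 5) + 2 := by
  cases pw with
  | nil => simp [isLDT]
  | cons a l =>
    have := scanT_time P P' a l
    simp only [isLDT, Timed.time_bind, time_tick, Timed.time_pure, List.length_cons,
      add_mul l.length 1, one_mul]
    omega

theorem feasibleT_time {m : ℕ} (P : List (Fin m)) (cj ck : Fin m) (pw : List (Fin m)) :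
    (feasibleT P cj ck pw).time ≤ pw.length + 8 * P.length + 14 := by
  cases pw with
  | nil => simp [feasibleT]
  | cons a l =>
    have h := lastT_time a l
    have h1 := beforeT_time cj a P
    have h2 := beforeT_time (lastT a l).val cj P
    have h3 := beforeT_time ck a P
    have h4 := beforeT_time (lastT a l).val ck P
    simp only [feasibleT, Timed.time_bind, time_tick, Timed.time_pure, List.length_cons]
    omega

/-- Four filtered pieces of `P` and two further entries. This crude bound holds for arbitrary lists,
so the timing needs no correctness. -/
theorem length_buildT_val {m : ℕ} (P : List (Fin m)) (q : List (Fin m × Fin m))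
    (cj ck z : Fin m) : (buildT P q cj ck z).val.length ≤ 4 * P.length + 2 := by
  have h1 := (aboveT_sublist z P).length_le
  have h2 := (fromT_sublist z P).length_le
  have hf : ∀ (f : Fin m → Bool) (l : List (Fin m)), l.length ≤ P.length →
      (l.filter f).length ≤ P.length := fun f l hl => (List.length_filter_le f l).trans hl
  simp only [buildT, Timed.val_bind, appendT_val, filterT_val, List.length_append,
    List.length_cons]
  have a1 := hf (fun x => (memT (cj, x) q).val) _ h1
  have a2 := hf (fun y => (memT (y, ck) q).val) _ h2
  have a3 := hf (fun x => (do
    let b ← memT (cj, x) q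
    return !b && decide (x ≠ cj) : Timed Bool).val) _ h1
  have a4 := hf (fun y => (do
    let b ← memT (y, ck) q
    return !b && decide (y ≠ ck) && decide (y ≠ cj) : Timed Bool).val) _ h2
  simp only [Timed.val_bind] at a3 a4
  omega

theorem buildT_time {m : ℕ} (P : List (Fin m)) (q : List (Fin m × Fin m)) (cj ck z : Fin m) :
    (buildT P q cj ck z).time ≤ 4 * (P.length * (q.length + 2)) + 5 * P.length + 10 := by
  have h1 := (aboveT_sublist z P).length_le
  have h2 := (fromT_sublist z P).length_le
  have hf : ∀ (f : Fin m → Bool) (l : List (Fin m)), l.length ≤ P.length →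
      (l.filter f).length ≤ P.length := fun f l hl => (List.length_filter_le f l).trans hl
  have ht : ∀ (f : Fin m → Timed Bool), (∀ x, (f x).time ≤ q.length + 1) →
      ∀ l : List (Fin m), l.length ≤ P.length →
      (filterT f l).time ≤ P.length * (q.length + 2) + 1 := fun f hf' l hl =>
    (filterT_time hf' l).trans (Nat.add_le_add_right (Nat.mul_le_mul_right _ hl) _)
  have a1 := ht (fun x => memT (cj, x) q) (fun x => memT_time _ _) _ h1
  have a2 := ht (fun y => memT (y, ck) q) (fun x => memT_time _ _) _ h2
  have a3 := ht (fun x => do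
    let b ← memT (cj, x) q
    return !b && decide (x ≠ cj)) (fun x => memT_time _ _) _ h1
  have a4 := ht (fun y => do
    let b ← memT (y, ck) q
    return !b && decide (y ≠ ck) && decide (y ≠ cj)) (fun x => memT_time _ _) _ h2
  have b1 := hf (fun x => (memT (cj, x) q).val) _ h1
  have b2 := hf (fun y => (memT (y, ck) q).val) _ h2
  have b3 := hf (fun x => (do
    let b ← memT (cj, x) q
    return !b && decide (x ≠ cj) : Timed Bool).val) _ h1
  have c0 := aboveT_time z P
  have c1 := fromT_time z P
  simp only [buildT, Timed.time_bind, time_tick]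
  rw [← filterT_val] at b1 b2 b3
  refine (Nat.add_le_add_left (Nat.add_le_add c0 (Nat.add_le_add c1 (Nat.add_le_add a3
    (Nat.add_le_add a1 (Nat.add_le_add a4 (Nat.add_le_add a2
    (Nat.add_le_add ((appendT_time _ _).trans (Nat.add_le_add_right b1 1))
    (Nat.add_le_add ((appendT_time _ _).trans (Nat.add_le_add_right b2 1))
    ((appendT_time _ _).trans (Nat.add_le_add_right b3 1))))))))) ) _).trans ?_
  omega

theorem loopT_time {m : ℕ} (P : List (Fin m)) (q : List (Fin m × Fin m)) (pw : List (Fin m))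
    (cj ck : Fin m) {K : ℕ}
    (hK : ∀ z, (buildT P q cj ck z).time + (swapDistT P (buildT P q cj ck z).val).time +
      (isLDT P (buildT P q cj ck z).val pw).time ≤ K)
    (dabs dloc : WithTop ℕ) (Ploc Z : List (Fin m)) :
    (loopT P q pw cj ck dabs dloc Ploc Z).time ≤ Z.length * (K + 1) + 1 := by
  induction Z generalizing dabs dloc Ploc with
  | nil => simp [loopT]
  | cons z Z ih =>
    have h := hK z
    simp only [loopT, Timed.time_bind, time_tick, List.length_cons, add_mul Z.length 1, one_mul]
    split_ifs
    all_goals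
      refine (Nat.add_le_add_left (Nat.add_le_add_left (Nat.add_le_add_left
        (Nat.add_le_add_left (ih _ _ _) _) _) _) _).trans ?_
      omega

theorem metaAlgorithm_time {m : ℕ} (P : List (Fin m)) (q : List (Fin m × Fin m))
    (pw : List (Fin m)) (cj ck : Fin m) :
    (metaAlgorithm P q pw cj ck).time ≤ pw.length + 10 * P.length + 18 +
      P.length * (4 * (P.length * (q.length + 2)) + 5 * P.length + 10 +
        ((4 * P.length + 2) * ((4 * P.length + 2) * (2 * P.length + 4) + 2) + 1) +
        (pw.length * (2 * P.length + 2 * (4 * P.length + 2) + 5) + 2) + 1) := by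
  have hK : ∀ z, (buildT P q cj ck z).time + (swapDistT P (buildT P q cj ck z).val).time +
      (isLDT P (buildT P q cj ck z).val pw).time ≤
      4 * (P.length * (q.length + 2)) + 5 * P.length + 10 +
        ((4 * P.length + 2) * ((4 * P.length + 2) * (2 * P.length + 4) + 2) + 1) +
        (pw.length * (2 * P.length + 2 * (4 * P.length + 2) + 5) + 2) := by
    intro z
    have h0 := length_buildT_val P q cj ck z
    refine Nat.add_le_add (Nat.add_le_add (buildT_time P q cj ck z) ?_) ?_
    · refine (swapDistT_time P _ h0).trans ?_
      gcongr
    · refine (isLDT_time P _ pw).trans ?_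
      gcongr
  have h1 := feasibleT_time P cj ck pw
  have h2 := fromT_time cj P
  have h3 := (fromT_sublist cj P).length_le
  have h4 := uptoT_time ck (fromT cj P).val
  have h5 := (uptoT_sublist ck (fromT cj P).val).length_le
  have h6 := loopT_time P q pw cj ck hK ⊤ ⊤ P (uptoT ck (fromT cj P).val).val
  have h7 := h6.trans (Nat.add_le_add_right (Nat.mul_le_mul_right _ (h5.trans h3)) 1)
  simp only [metaAlgorithm, Timed.time_bind, time_tick]
  split_ifs
  · simp only [Timed.time_bind]
    omega
  · simp only [Timed.time_pure]
    omega

end IterVoting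

theorem theorem2 :
    -- polynomial running time
    (∃ p : Polynomial ℕ, ∀ (n m : ℕ) (T : IterVoting.Pref m)
      (Q : Fin n → IterVoting.Responses m) (i : Fin n) (P : IterVoting.Pref m)
      (q : List (Fin m × Fin m)) (pw : List (Fin m)) (cj ck : Fin m),
      IterVoting.CommonGivens T Q i P q pw cj ck →
        (IterVoting.metaAlgorithm P.order q pw cj ck).time ≤ p.eval m) ∧
    -- correctness
    (∀ (n m : ℕ) (T : IterVoting.Pref m)
      (Q : Fin n → IterVoting.Responses m) (i : Fin n) (P : IterVoting.Pref m)
      (q : List (Fin m × Fin m)) (pw : List (Fin m)) (cj ck : Fin m),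
      4 ≤ n → IterVoting.CommonGivens T Q i P q pw cj ck →
      (∃ P', IterVoting.LocallyDominant T Q i P P' ∧ P' ∈ IterVoting.mu (Q i) P cj ck) →
        ∃ P', (IterVoting.metaAlgorithm P.order q pw cj ck).val = P'.order ∧
          IterVoting.LocallyDominant T Q i P P' ∧ P' ∈ IterVoting.mu (Q i) P cj ck) ∧
    -- the orders built in the main loop comprise all of `μ(P)`
    (∀ (n m : ℕ) (T : IterVoting.Pref m)
      (Q : Fin n → IterVoting.Responses m) (i : Fin n) (P : IterVoting.Pref m)
      (q : List (Fin m × Fin m)) (pw : List (Fin m)) (cj ck : Fin m),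
      IterVoting.CommonGivens T Q i P q pw cj ck →
      ∀ P' ∈ IterVoting.mu (Q i) P cj ck,
        ∃ z, (z = cj ∨ P.prefers cj z) ∧ (z = ck ∨ P.prefers z ck) ∧
          (IterVoting.buildT P.order q cj ck z).val = P'.order) := by
  refine ⟨?_, ?_, ?_⟩
  · open Polynomial in
    -- The bound of `metaAlgorithm_time` with `m` for the lengths of `P` and `pw`, and `m * m` for
    -- that of `q`; `pw` and `q` have no repetitions.
    refine ⟨X + 10 * X + 18 + X * (4 * (X * (X * X + 2)) + 5 * X + 10 +
        ((4 * X + 2) * ((4 * X + 2) * (2 * X + 4) + 2) + 1) +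
        (X * (2 * X + 2 * (4 * X + 2) + 5) + 2) + 1), ?_⟩
    intro n m T Q i P q pw cj ck hg
    have hP := P.length_order
    have hpw : pw.length ≤ m := by
      simpa using List.Nodup.length_le_card (hg.pw_sorted.imp fun {a b} h => h.ne)
    have hq : q.length ≤ m * m := by
      simpa using hg.closure_nodup.length_le_card
    refine (IterVoting.metaAlgorithm_time P.order q pw cj ck).trans ?_
    simp only [hP, Polynomial.eval_add, Polynomial.eval_mul, Polynomial.eval_X,
      Polynomial.eval_ofNat, Polynomial.eval_one]
    gcongr
  · rintro n m T Q i P q pw cj ck hn hg ⟨P', hLD, hmu⟩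
    exact IterVoting.metaAlgorithm_correct hn hg hLD hmu
  · intro n m T Q i P q pw cj ck hg P' hmu
    obtain ⟨z, hz, hz', rfl⟩ :=
      IterVoting.exists_pivot_of_mem_mu hg.consistent hg.query hmu
    exact ⟨z, hz, hz', IterVoting.buildT_val hg.consistent hg.closure_mem hg.query
      hg.uncommitted.1 hz hz'⟩
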